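/- **Setting.** Let $\mathcal X$ be a measurable space, $\mathcal Y=\{1,\dots,C\}$, and let $\mathcal D$ be a probability distribution on $\mathcal X\times\mathcal Y$. Models map images to $\mathbb R^C$ with the Euclidean norm. Their outputs lie in a bounded set $\mathcal O\subset\mathbb R^C$ (for example the probability simplex, when the outputs are predicted class probabilities). The loss $\mathcal L\ge 0$ is such that $\mathcal L(\cdot,y)$ is Lipschitz on $\mathcal O$ with constant $L\le 2$ for every $y$. *Training data.* Let $(x_1,y_1),\dots,(x_n,y_n)$, $n\ge1$, be i.i.d. from $\mathcal D$. From each $(x_i,y_i)$ a generator $G$ draws $m\ge 0$ further images $x_i^1,\dots,x_i^m$, which get the label $y_i$, and the blocks $(x_i,y_i,x_i^1,\dots,x_i^m)$ are independent. For $m=0$ there is no data augmentation and nothing is assumed of $G$. For $m\ge1$ each pair $(x_i^k,y_i)$ has law $\mathcal D$. *Poisoning.* Let $c\in\mathcal Y$ be the target class and $0\le\alpha<1$. Given the labels, and without looking at the images, the attacker randomly samples a set $S$ of items (original or generated) of class $c$ that contains at most the fraction $\alpha$ of all the items of class $c$. The images in $S$ are replaced by arbitrary poisoned images and no label is changed.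 The result is the poisoned training set $\mathbf D_p$, with $n(m+1)$ items. The empirical risk of a model $g$ is $\mathcal R(g,\mathbf D_p)=\frac1{n(m+1)}\sum_{(x,y)\in\mathbf D_p}\mathcal L(g(x),y)$. *Models.* Let $f(\cdot;\theta):\mathcal X\to\mathcal O$, $\theta\in\Theta$, be measurable in $x$ and continuous in $\theta$, where $\Theta$ is a second countable topological space (for example $\Theta\subseteq\mathbb R^p$). Let $\mathcal E_o(f(\cdot;\theta),\mathcal D)=\mathbb E_{(X,Y)\sim\mathcal D}[\mathcal L(f(X;\theta),Y)]$. Let $T\ge0$ satisfy $$\mathrm{Rad}_n:=\mathbb E_{x}\,\mathbb E_{\sigma}\,\sup_{\theta\in\Theta}\frac1n\sum_{i=1}^n\sum_{j=1}^C\sigma_{ij}f_j(x_i;\theta)\le\sqrt{T/n},$$ where $x_1,\dots,x_n$ are independent images with the $\mathcal X$-marginal law of $\mathcal D$ and the $\sigma_{ij}$ are independent uniform signs. **Theorem.** There is a constant $K\ge0$ that depends only on $C$, $\mathcal O$, $\mathcal L$ (and $L$) such that, in every such setting and for every $\delta>0$, the following holds with probability at least $1-\delta-K/n$, simultaneously for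 all choices of poisoned images, of a surrogate model $h:\mathcal X\to\mathcal O$ and of a real number $\eta$. Let $\xi=\mathcal R(h,\mathbf D_p)$, and suppose that some $\theta^*\in\Theta$ satisfies $\|f(x;\theta^*)-h(x)\|\le\eta$ for all $x\in\mathcal X$. Then for every minimizer $\theta$ of $\mathcal R(f(\cdot;\theta),\mathbf D_p)$ over $\Theta$ (the trained victim), and also for $\theta=\theta^*$, $$\mathcal E_o(f(\cdot;\theta),\mathcal D)\le\frac{4-2\alpha}{1-\alpha}(\xi+2\eta)+K\left(\sqrt{\frac{T}{n(1-\alpha)^2}}+\sqrt{\frac{\ln(2/\delta)}{n(1-\alpha)}}\right).$$ (With probability at least $1-p$ means that the outer probability of the complementary event is at most $p$.) -/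

import Mathlib

open MeasureTheory ProbabilityTheory
open scoped NNReal ENNReal

noncomputable section

namespace CleanLabel

/-- Model outputs: one real score (for instance a predicted probability) per class,
with the Euclidean norm. -/
abbrev Output (C : ℕ) := EuclideanSpace ℝ (Fin C)

/-- What a single original sample contributes to the data: the labelled original image `(x, y)`
and `m` images generated from it. Without data augmentation `m = 0`. -/
abbrev Block (X : Type*) (C m : ℕ) := (X × Fin C) × (Fin m → X)

/-- The training items: `(i, none)` is the `i`-th original image, and `(i, some k)` is the `k`-th
image generated from it. -/
abbrev Item (n m : ℕ) := Fin n × Option (Fin m)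

/-- A poisoning mask: `s it = true` means that the item `it` is replaced by a poisoned image. -/
abbrev Mask (n m : ℕ) := Item n m → Bool

variable {X : Type*} {C n m : ℕ}

/-- The images of a block. -/
def Block.image (b : Block X C m) : Option (Fin m) → X
  | none => b.1.1
  | some k => b.2 k

/-- The labels of the samples; generated images inherit the label of their original. -/
def labels (w : Fin n → Block X C m) : Fin n → Fin C := fun i => (w i).1.2

/-- The number of target-class training items, original and generated. -/
def targetCount (m : ℕ) (c : Fin C) (y : Fin n → Fin C) : ℕ :=
  (Finset.univ.filter fun it : Item n m => y it.1 = c).card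

/-- The number of poisoned items. -/
def poisonCount (s : Mask n m) : ℕ := (Finset.univ.filter fun it => s it = true).card

/-- A rule by which the attacker samples, given the labels, the items to be poisoned. It is a
clean-label selection of poison rate (at most) `α` if it only ever selects items of the target
class `c`, and at most the fraction `α` of them. -/
def IsSelection (c : Fin C) (α : ℝ) (sel : (Fin n → Fin C) → PMF (Mask n m)) : Prop :=
  ∀ y, ∀ s ∈ (sel y).support,
    (∀ it, s it = true → y it.1 = c) ∧ (poisonCount s : ℝ) ≤ α * targetCount m c y

/-- The poisoned images: `x'` on the items selected by `s`, the unpoisoned image elsewhere.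
The labels are not changed. -/
def poisonedImages (w : Fin n → Block X C m) (s : Mask n m) (x' : Item n m → X) :
    Item n m → X :=
  fun it => if s it = true then x' it else (w it.1).image it.2

/-- The empirical risk of a model `g` on a training set given by its images and labels. -/
def empRisk (loss : Output C → Fin C → ℝ) (g : X → Output C) (x : Item n m → X)
    (y : Fin n → Fin C) : ℝ :=
  (∑ it, loss (g (x it)) (y it.1)) / Fintype.card (Item n m)

/-- `θ` minimizes the empirical risk over all parameters. -/
def IsERM {Θ : Type*} (loss : Output C → Fin C → ℝ) (f : Θ → X → Output C) (x : Item n m → X)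
    (y : Fin n → Fin C) (θ : Θ) : Prop :=
  ∀ θ', empRisk loss (f θ) x y ≤ empRisk loss (f θ') x y

variable [MeasurableSpace X]

/-- The clean generalization error `E_{(x, y) ∼ D} [loss (g x) y]`. -/
def cleanError (loss : Output C → Fin C → ℝ) (D : Measure (X × Fin C)) (g : X → Output C) : ℝ :=
  ∫ z, loss (g z.1) z.2 ∂D

/-- The value `±1` of a sign. -/
def sign (b : Bool) : ℝ := if b then 1 else -1

/-- The Rademacher complexity for samples of size `n` of the class of (vector-valued) models
`f θ`, with independent signs for all samples and all output coordinates: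
`E_x E_σ sup_θ (1 / n) ∑_i ∑_j σ_{ij} (f θ x_i)_j`. -/
def rademacher {Θ : Type*} (n : ℕ) (D : Measure (X × Fin C)) (f : Θ → X → Output C) : ℝ :=
  ∫ z : Fin n → X × Fin C,
    (∑ σ : Fin n → Fin C → Bool,
      ⨆ θ, (1 / (n : ℝ)) * ∑ i, ∑ j, sign (σ i j) * f θ (z i).1 j) /
        Fintype.card (Fin n → Fin C → Bool)
    ∂(Measure.pi fun _ => D)

theorem measurable_labels : Measurable (labels : (Fin n → Block X C m) → Fin n → Fin C) := by
  unfold labels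
  fun_prop

/-- The joint law of the data and of the poisoning mask: the blocks are independent, each consists
of a labelled image with law `D` and of `m` images drawn by the generator `G` from it, and given
the labels the mask is drawn by `sel`, without using the images. -/
def attackLaw (D : Measure (X × Fin C)) (G : Kernel (X × Fin C) (Fin m → X))
    (sel : (Fin n → Fin C) → PMF (Mask n m)) :
    Measure ((Fin n → Block X C m) × Mask n m) :=
  (Measure.pi fun _ : Fin n => D.compProd G).compProd
    ((Kernel.ofFunOfCountable fun y => (sel y).toMeasure).comap labels measurable_labels)

end CleanLabel

end

/-!
The proof conditions on the labels. Given the label vector `y` and the mask `s`, the blocks are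
independent and the block `i` has the law of a block with label `y i` (`attackLaw_le`, `cond_pi`),
because the mask is drawn without using the images. Reweight the items: poisoned items get the
weight `0`, and the unpoisoned items of the target class share the weight of the whole class
(`weight`). Each class then has its empirical frequency as total weight, no weight exceeds
`1 / ((1 - α) n (m + 1))`, and the weighted loss of the unpoisoned data is at most `1 / (1 - α)`
times the empirical risk on the poisoned data (`sum_weight_mul_loss_le`). So the clean error exceeds
this multiple of the empirical risk by at most the error of the class frequencies, a matter of
binomial tails, plus `deviation`, the largest weighted deviation over the model class of the losses
from their conditional means. As `1 / (1 - α) ≤ (4 - 2 α) / (1 - α)`, and the empirical risk of the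
minimizer and of `θ*` is at most `ξ + 2 η`, it remains to bound the deviation.

* Fluctuation: McDiarmid's inequality (`measureReal_ge_le_of_bounded_differences`). The total
  weights of the blocks are at most `1 / (n (1 - α))` and sum to `1`, so the sum of their squares is
  at most `1 / (n (1 - α))`; this is where the square root of `ln (2 / δ) / (n (1 - α))` comes from.
* Mean: symmetrization (`integral_sup_deviation_le`) and the vector contraction inequality
  (`rad_contraction`), position by position in the blocks and class by class. What remains is
  `1 / (n (1 - α))` times the Rademacher averages `partRad` of samples of each class, of random
  size.

The assumption on the Rademacher complexity concerns unconditioned samples. An additive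
concentration inequality for the conditional Rademacher averages would cost a factor `1 / (1 - α)`
in front of `√(ln (2 / δ) / n)`, which is too much, so the comparison is multiplicative. The average
over a part of an i.i.d. sample is nondecreasing and subadditive in the part and depends only on
its size, so the averages over parts of sizes `k` and `l` are comparable up to the factor
`1 + k / l` (`card_mul_partRad_le`). As a class has at most about twice its expected number
of points in the sample, and, unless few are expected, a constant fraction of it with probability
bounded below, the average over the class is at most a constant times the full Rademacher average, up to a
term linear in `ln (2 / δ)` (`partRad_cond_le`). After division by `n (1 - α)` that term is dominated by
the square root of `ln (2 / δ) / (n (1 - α))`, except where this quantity exceeds `1` and the claim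
is trivial.

Measurability of suprema is dealt with by passing to a countable dense set of parameters and
extending the final inequality by continuity.
-/

noncomputable section

namespace CleanLabel

open scoped BigOperators

/-! ### Rademacher averages and vector contraction -/

section Rademacher

variable {ι J : Type*} [Fintype J] {n : ℕ}

/-- A real-valued family is bounded. -/
def Bdd (g : ι → ℝ) : Prop := ∃ M, ∀ t, |g t| ≤ M

theorem Bdd.bddAbove {g : ι → ℝ} (h : Bdd g) : BddAbove (Set.range g) := by
  obtain ⟨M, hM⟩ := h
  exact ⟨M, by rintro _ ⟨t, rfl⟩; exact (le_abs_self _).trans (hM t)⟩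

theorem Bdd.le_ciSup {g : ι → ℝ} (h : Bdd g) (t : ι) : g t ≤ ⨆ t, g t :=
  _root_.le_ciSup h.bddAbove t

theorem Bdd.add {g h : ι → ℝ} (hg : Bdd g) (hh : Bdd h) : Bdd fun t => g t + h t := by
  obtain ⟨M, hM⟩ := hg
  obtain ⟨N, hN⟩ := hh
  exact ⟨M + N, fun t => (abs_add_le _ _).trans (add_le_add (hM t) (hN t))⟩

theorem Bdd.const_mul {g : ι → ℝ} (hg : Bdd g) (c : ℝ) : Bdd fun t => c * g t := by
  obtain ⟨M, hM⟩ := hg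
  exact ⟨|c| * M, fun t => by rw [abs_mul]; gcongr; exact hM t⟩

theorem Bdd.sum {κ : Type*} {s : Finset κ} {g : κ → ι → ℝ} (hg : ∀ k ∈ s, Bdd (g k)) :
    Bdd fun t => ∑ k ∈ s, g k t := by
  choose! M hM using hg
  exact ⟨∑ k ∈ s, M k, fun t => (Finset.abs_sum_le_sum_abs _ _).trans
    (Finset.sum_le_sum fun k hk => hM k hk t)⟩

theorem abs_sign (b : Bool) : |sign b| = 1 := by cases b <;> simp [sign]

theorem sign_not (b : Bool) : sign (!b) = -sign b := by cases b <;> simp [sign]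

/-- The signed sum `∑_i ∑_j σ_{ij} a_{ij}`. -/
def signSum (σ : Fin n → J → Bool) (a : Fin n → J → ℝ) : ℝ := ∑ i, ∑ j, sign (σ i j) * a i j

theorem bdd_signSum {a : ι → Fin n → J → ℝ} (ha : ∀ i j, Bdd fun t => a t i j)
    (σ : Fin n → J → Bool) : Bdd fun t => signSum σ (a t) :=
  Bdd.sum fun _ _ => Bdd.sum fun _ _ => (ha _ _).const_mul _

theorem signSum_add (σ : Fin n → J → Bool) (a b : Fin n → J → ℝ) :
    signSum σ (fun i j => a i j + b i j) = signSum σ a + signSum σ b := by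
  simp [signSum, mul_add, Finset.sum_add_distrib]

theorem abs_signSum_le (σ : Fin n → J → Bool) (a : Fin n → J → ℝ) :
    |signSum σ a| ≤ ∑ i, ∑ j, |a i j| := by
  refine (Finset.abs_sum_le_sum_abs _ _).trans (Finset.sum_le_sum fun i _ => ?_)
  refine (Finset.abs_sum_le_sum_abs _ _).trans (Finset.sum_le_sum fun j _ => ?_)
  rw [abs_mul, abs_sign, one_mul]

/-- Flipping the signs outside `p`. -/
def flipSigns (p : Fin n → J → Prop) [∀ i j, Decidable (p i j)] :
    Equiv.Perm (Fin n → J → Bool) :=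
  Function.Involutive.toPerm (fun σ i j => if p i j then σ i j else !(σ i j)) fun σ => by
    ext i j; by_cases h : p i j <;> simp [h]

theorem signSum_flipSigns (p : Fin n → J → Prop) [∀ i j, Decidable (p i j)]
    (σ : Fin n → J → Bool) (a : Fin n → J → ℝ) :
    signSum σ a + signSum (flipSigns p σ) a
      = 2 * signSum σ fun i j => if p i j then a i j else 0 := by
  simp only [signSum, ← Finset.sum_add_distrib, Finset.mul_sum]
  refine Finset.sum_congr rfl fun i _ => Finset.sum_congr rfl fun j _ => ?_
  by_cases h : p i j <;> simp [flipSigns, Function.Involutive.toPerm, h, sign_not]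
  ring

variable [DecidableEq J]

/-- The average over independent uniform signs of `sup_t ∑_i ∑_j σ_{ij} a^t_{ij}`: the empirical
Rademacher complexity of the family `a`, not divided by the sample size. -/
def rad (a : ι → Fin n → J → ℝ) : ℝ := 𝔼 σ : Fin n → J → Bool, ⨆ t, signSum σ (a t)

theorem rad_add_le [Nonempty ι] {a b : ι → Fin n → J → ℝ} (ha : ∀ i j, Bdd fun t => a t i j)
    (hb : ∀ i j, Bdd fun t => b t i j) :
    rad (fun t i j => a t i j + b t i j) ≤ rad a + rad b := by
  unfold rad
  rw [← Finset.expect_add_distrib]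
  refine Finset.expect_le_expect fun σ _ => ciSup_le fun t => ?_
  rw [signSum_add]
  exact add_le_add ((bdd_signSum ha σ).le_ciSup t) ((bdd_signSum hb σ).le_ciSup t)

theorem rad_le_of_abs_le [Nonempty ι] {a : ι → Fin n → J → ℝ} {b : Fin n → J → ℝ}
    (hab : ∀ t i j, |a t i j| ≤ b i j) : rad a ≤ ∑ i, ∑ j, b i j := by
  refine Finset.expect_le Finset.univ_nonempty fun σ _ => ciSup_le fun t => ?_
  exact (le_abs_self _).trans ((abs_signSum_le _ _).trans
    (Finset.sum_le_sum fun i _ => Finset.sum_le_sum fun j _ => hab t i j))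

theorem abs_rad_le [Nonempty ι] {a : ι → Fin n → J → ℝ} {b : Fin n → J → ℝ}
    (hab : ∀ t i j, |a t i j| ≤ b i j) : |rad a| ≤ ∑ i, ∑ j, b i j := by
  refine abs_le.2 ⟨?_, rad_le_of_abs_le hab⟩
  refine Finset.le_expect Finset.univ_nonempty fun σ _ => ?_
  obtain ⟨t⟩ := ‹Nonempty ι›
  refine le_trans ?_ ((bdd_signSum (fun i j => ⟨b i j, fun t => hab t i j⟩) σ).le_ciSup t)
  exact neg_le_of_abs_le ((abs_signSum_le _ _).trans
    (Finset.sum_le_sum fun i _ => Finset.sum_le_sum fun j _ => hab t i j))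

/-- Dropping terms does not increase the Rademacher average: the signs of the dropped terms can
be averaged out. -/
theorem rad_restrict_le [Nonempty ι] {a : ι → Fin n → J → ℝ} (ha : ∀ i j, Bdd fun t => a t i j)
    (p : Fin n → J → Prop) [∀ i j, Decidable (p i j)] :
    rad (fun t i j => if p i j then a t i j else 0) ≤ rad a := by
  have h1 : rad a = 𝔼 σ : Fin n → J → Bool, ⨆ t, signSum (flipSigns p σ) (a t) :=
    (Fintype.expect_equiv (flipSigns p) _ _ fun _ => rfl).symm
  suffices h : rad (fun t i j => if p i j then a t i j else 0) ≤ (rad a + rad a) / 2 by linarith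
  nth_rw 2 [h1]
  unfold rad
  rw [← Finset.expect_add_distrib, Finset.expect_div]
  refine Finset.expect_le_expect fun σ _ => ciSup_le fun t => ?_
  have h2 := signSum_flipSigns p σ (a t)
  have h3 := (bdd_signSum ha σ).le_ciSup t
  have h4 := (bdd_signSum ha (flipSigns p σ)).le_ciSup t
  linarith

theorem rad_nonneg [Nonempty ι] {a : ι → Fin n → J → ℝ} (ha : ∀ i j, Bdd fun t => a t i j) :
    0 ≤ rad a := by
  have h := rad_restrict_le ha fun _ _ => False
  refine le_trans (le_of_eq ?_) h
  simp [rad, signSum]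

theorem rad_comp_perm (e : Equiv.Perm (Fin n)) (a : ι → Fin n → J → ℝ) :
    rad (fun t i => a t (e i)) = rad a := by
  refine Fintype.expect_equiv (Equiv.arrowCongr e (Equiv.refl (J → Bool))) _ _ fun σ => ?_
  congr 1; ext t
  exact Fintype.sum_equiv e _ _ fun i => by simp [Equiv.arrowCongr]

theorem rad_const_mul {c : ℝ} (hc : 0 ≤ c) (a : ι → Fin n → J → ℝ) :
    rad (fun t i j => c * a t i j) = c * rad a := by
  unfold rad
  rw [Finset.mul_expect]
  refine Finset.expect_congr rfl fun σ _ => ?_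
  rw [Real.mul_iSup_of_nonneg hc]
  congr 1; ext t
  simp only [signSum, Finset.mul_sum]
  exact Finset.sum_congr rfl fun i _ => Finset.sum_congr rfl fun j _ => by ring

/-- A weak Khintchine inequality: `max_j |v_j| ≤ E_ε |∑_j ε_j v_j|`. -/
theorem norm_le_expect_abs_sum (v : J → ℝ) :
    ‖v‖ ≤ 𝔼 ε : J → Bool, |∑ j, sign (ε j) * v j| := by
  refine (pi_norm_le_iff_of_nonneg (Finset.expect_nonneg fun _ _ => abs_nonneg _)).2 fun k => ?_
  -- flip all signs but the `k`-th one
  let e : Equiv.Perm (J → Bool) :=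
    Function.Involutive.toPerm (fun ε j => if j = k then ε j else !(ε j)) fun ε => by
      ext j; by_cases h : j = k <;> simp [h]
  have h1 : 𝔼 ε : J → Bool, |∑ j, sign (ε j) * v j|
      = 𝔼 ε : J → Bool, |∑ j, sign (e ε j) * v j| :=
    (Fintype.expect_equiv e _ _ fun _ => rfl).symm
  suffices h : ‖v k‖ ≤ (𝔼 ε : J → Bool, |∑ j, sign (ε j) * v j|
      + 𝔼 ε : J → Bool, |∑ j, sign (ε j) * v j|) / 2 by linarith
  nth_rw 2 [h1]
  rw [← Finset.expect_add_distrib, Finset.expect_div]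
  refine Finset.le_expect Finset.univ_nonempty fun ε _ => ?_
  have h2 : ∑ j, sign (ε j) * v j + ∑ j, sign (e ε j) * v j = 2 * (sign (ε k) * v k) := by
    rw [← Finset.sum_add_distrib, Finset.sum_eq_single k]
    · simp [e, Function.Involutive.toPerm]; ring
    · intro j _ hj
      simp [e, Function.Involutive.toPerm, hj, sign_not]
    · simp
  have h3 := abs_add_le (∑ j, sign (ε j) * v j) (∑ j, sign (e ε j) * v j)
  rw [h2, abs_mul, abs_mul, abs_sign, abs_two, one_mul] at h3
  rw [Real.norm_eq_abs]; linarith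

/-- One step of the vector contraction inequality: a single sign in front of `ψ` is replaced by
independent signs in front of the coordinates of `φ`. -/
theorem expect_sup_contraction_step [Nonempty ι] {A ψ : ι → ℝ} {φ : ι → J → ℝ} (hA : Bdd A)
    (hφ : ∀ j, Bdd fun t => φ t j) (h : ∀ t t', |ψ t - ψ t'| ≤ ‖φ t - φ t'‖) :
    𝔼 b : Bool, ⨆ t, (A t + sign b * ψ t)
      ≤ 𝔼 ε : J → Bool, ⨆ t, (A t + ∑ j, sign (ε j) * φ t j) := by
  set R := 𝔼 ε : J → Bool, ⨆ t, (A t + ∑ j, sign (ε j) * φ t j) with hR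
  have hb : ∀ ε : J → Bool, Bdd fun t => A t + ∑ j, sign (ε j) * φ t j := fun ε =>
    hA.add (Bdd.sum fun j _ => (hφ j).const_mul _)
  -- the same average with all signs flipped
  have hR' : R = 𝔼 ε : J → Bool, ⨆ t, (A t - ∑ j, sign (ε j) * φ t j) := by
    refine Fintype.expect_equiv (Function.Involutive.toPerm (fun ε j => !(ε j)) fun ε => by simp)
      _ _ fun ε => ?_
    congr 1; ext t
    simp [Function.Involutive.toPerm, sign_not]
  have hb' : ∀ ε : J → Bool, Bdd fun t => A t - ∑ j, sign (ε j) * φ t j := fun ε => by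
    simpa [sign_not, sub_eq_add_neg] using hb fun j => !(ε j)
  have key : ∀ t t', (A t + ψ t) + (A t' - ψ t') ≤ 2 * R := fun t t' => by
    have h1 : A t + A t' + 𝔼 ε : J → Bool, |∑ j, sign (ε j) * (φ t - φ t') j| ≤ R + R := by
      nth_rw 2 [hR']
      rw [hR, ← Finset.expect_add_distrib]
      conv_lhs => rw [← Fintype.expect_const (ι := J → Bool) (A t + A t')]
      rw [← Finset.expect_add_distrib]
      refine Finset.expect_le_expect fun ε _ => ?_
      have e : ∑ j, sign (ε j) * (φ t - φ t') j
          = ∑ j, sign (ε j) * φ t j - ∑ j, sign (ε j) * φ t' j := by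
        simp [mul_sub]
      rw [e]
      have l1 := (hb ε).le_ciSup t
      have l2 := (hb ε).le_ciSup t'
      have l3 := (hb' ε).le_ciSup t
      have l4 := (hb' ε).le_ciSup t'
      rcases abs_cases (∑ j, sign (ε j) * φ t j - ∑ j, sign (ε j) * φ t' j) with h | h <;>
        linarith [h.1]
    have h2 := norm_le_expect_abs_sum (φ t - φ t')
    have h3 := (le_abs_self _).trans (h t t')
    linarith
  have h0 : 𝔼 b : Bool, ⨆ t, (A t + sign b * ψ t)
      = ((⨆ t, (A t + ψ t)) + ⨆ t, (A t - ψ t)) / 2 := by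
    rw [Finset.expect_eq_sum_div_card]
    simp [sign, sub_eq_add_neg]
  rw [h0, div_le_iff₀ two_pos, mul_comm]
  exact ciSup_add_ciSup_le key

/-- The induction behind `rad_contraction`; the offset `A` carries the terms of the signs that are
already fixed. -/
theorem contraction_aux [Nonempty ι] : ∀ {n : ℕ} {A : ι → ℝ} {ψ : ι → Fin n → ℝ}
    {φ : ι → Fin n → J → ℝ}, Bdd A → (∀ i, Bdd fun t => ψ t i) → (∀ i j, Bdd fun t => φ t i j) →
    (∀ t t' i, |ψ t i - ψ t' i| ≤ ‖φ t i - φ t' i‖) →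
    𝔼 σ : Fin n → Bool, ⨆ t, (A t + ∑ i, sign (σ i) * ψ t i)
      ≤ 𝔼 σ : Fin n → J → Bool, ⨆ t, (A t + signSum σ (φ t)) := by
  intro n
  induction n with
  | zero =>
    intro A ψ φ _ _ _ _
    simp [signSum]
  | succ n ih =>
    intro A ψ φ hA hψ hφ h
    have e1 : 𝔼 σ : Fin (n + 1) → Bool, ⨆ t, (A t + ∑ i, sign (σ i) * ψ t i)
        = 𝔼 b : Bool, 𝔼 σ : Fin n → Bool,
          ⨆ t, ((A t + sign b * ψ t 0) + ∑ i, sign (σ i) * ψ t i.succ) := by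
      rw [← Finset.expect_product', Finset.univ_product_univ]
      refine (Fintype.expect_equiv (Fin.consEquiv fun _ => Bool) _ _ fun x => ?_).symm
      simp [Fin.consEquiv, Fin.sum_univ_succ, add_assoc]
    have e2 : 𝔼 σ : Fin (n + 1) → J → Bool, ⨆ t, (A t + signSum σ (φ t))
        = 𝔼 σ : Fin n → J → Bool, 𝔼 ε : J → Bool,
          ⨆ t, ((A t + signSum σ fun i => φ t i.succ) + ∑ j, sign (ε j) * φ t 0 j) := by
      rw [Finset.expect_comm, ← Finset.expect_product', Finset.univ_product_univ]
      refine (Fintype.expect_equiv (Fin.consEquiv fun _ => J → Bool) _ _ fun x => ?_).symm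
      congr 1; ext t
      simp only [Fin.consEquiv, Equiv.coe_fn_mk, signSum, Fin.sum_univ_succ, Fin.cons_zero,
        Fin.cons_succ]
      ring
    rw [e1, e2]
    calc _ ≤ 𝔼 b : Bool, 𝔼 σ : Fin n → J → Bool,
          ⨆ t, ((A t + sign b * ψ t 0) + signSum σ fun i => φ t i.succ) :=
          Finset.expect_le_expect fun b _ => ih (hA.add ((hψ 0).const_mul _))
            (fun i => hψ i.succ) (fun i j => hφ i.succ j) fun t t' i => h t t' i.succ
      _ = 𝔼 σ : Fin n → J → Bool, 𝔼 b : Bool,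
          ⨆ t, ((A t + signSum σ fun i => φ t i.succ) + sign b * ψ t 0) := by
          rw [Finset.expect_comm]; simp only [add_right_comm]
      _ ≤ _ := Finset.expect_le_expect fun σ _ => expect_sup_contraction_step
          (hA.add (bdd_signSum (fun i j => hφ i.succ j) σ)) (fun j => hφ 0 j)
          fun t t' => h t t' 0

/-- The vector contraction inequality: if `ψ^t_i` is a `1`-Lipschitz function of the vector
`φ^t_i` for the maximum norm, then the Rademacher average of the scalars is at most that of
the vectors with independent signs in all coordinates. -/
theorem rad_contraction [Nonempty ι] {ψ : ι → Fin n → ℝ} {φ : ι → Fin n → J → ℝ}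
    (hψ : ∀ i, Bdd fun t => ψ t i) (hφ : ∀ i j, Bdd fun t => φ t i j)
    (h : ∀ t t' i, |ψ t i - ψ t' i| ≤ ‖φ t i - φ t' i‖) :
    𝔼 σ : Fin n → Bool, ⨆ t, ∑ i, sign (σ i) * ψ t i ≤ rad φ := by
  simpa [rad] using contraction_aux (A := fun _ => 0) ⟨0, by simp⟩ hψ hφ h

end Rademacher

/-! ### Concentration, symmetrization and product measures -/

section Tools

variable {Z ι : Type*} [MeasurableSpace Z] {n : ℕ}

theorem integrable_of_bdd {Ω : Type*} [MeasurableSpace Ω] {μ : Measure Ω} [IsFiniteMeasure μ]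
    {F : Ω → ℝ} (hF : Measurable F) (hb : Bdd F) : Integrable F μ := by
  obtain ⟨M, hM⟩ := hb
  exact Integrable.of_bound hF.aestronglyMeasurable M (Filter.Eventually.of_forall hM)

theorem integral_comp_of_measurePreserving {Ω Ω' : Type*} [MeasurableSpace Ω] [MeasurableSpace Ω']
    {μ : Measure Ω} {ν : Measure Ω'} {e : Ω → Ω'} (he : MeasurePreserving e μ ν) {G : Ω' → ℝ}
    (hG : Measurable G) : ∫ x, G (e x) ∂μ = ∫ y, G y ∂ν := by
  rw [← he.map_eq, integral_map he.measurable.aemeasurable hG.aestronglyMeasurable]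

theorem abs_integral_le_of_abs_le {Ω : Type*} [MeasurableSpace Ω] {μ : Measure Ω}
    [IsProbabilityMeasure μ] {F : Ω → ℝ} {M : ℝ} (hM : ∀ x, |F x| ≤ M) : |∫ x, F x ∂μ| ≤ M := by
  have h : ∀ᵐ x ∂μ, ‖F x‖ ≤ M := Filter.Eventually.of_forall hM
  simpa using norm_integral_le_of_norm_le_const h

theorem abs_ciSup_le [Nonempty ι] {g : ι → ℝ} {M : ℝ} (h : ∀ t, |g t| ≤ M) : |⨆ t, g t| ≤ M := by
  obtain ⟨t⟩ := ‹Nonempty ι›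
  exact abs_le.2 ⟨(neg_le_of_abs_le (h t)).trans (Bdd.le_ciSup ⟨M, h⟩ t),
    ciSup_le fun t => (le_abs_self _).trans (h t)⟩

theorem Bdd.comp {α : Type*} {g : ι → ℝ} (hg : Bdd g) (e : α → ι) : Bdd fun x => g (e x) := by
  obtain ⟨M, hM⟩ := hg
  exact ⟨M, fun x => hM _⟩

/-- Hoeffding's lemma for a function whose oscillation is at most `c`. -/
theorem integral_exp_le_of_oscillation {μ : Measure Z} [IsProbabilityMeasure μ] {f : Z → ℝ}
    (hf : Measurable f) {c : ℝ} (hc : ∀ x y, |f x - f y| ≤ c) (t : ℝ) :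
    ∫ x, Real.exp (t * (f x - ∫ y, f y ∂μ)) ∂μ ≤ Real.exp (t ^ 2 * c ^ 2 / 8) := by
  obtain ⟨z⟩ : Nonempty Z := by
    by_contra h
    rw [not_nonempty_iff] at h
    exact IsProbabilityMeasure.ne_zero μ (Measure.eq_zero_of_isEmpty μ)
  have hc0 : 0 ≤ c := (abs_nonneg _).trans (hc z z)
  have hbd : BddBelow (Set.range f) :=
    ⟨f z - c, by rintro _ ⟨x, rfl⟩; linarith [(le_abs_self _).trans (hc z x)]⟩
  have : Nonempty Z := ⟨z⟩
  have hmem : ∀ x, f x ∈ Set.Icc (⨅ y, f y) ((⨅ y, f y) + c) := fun x =>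
    ⟨ciInf_le hbd x, by
      rw [← sub_le_iff_le_add]
      exact le_ciInf fun y => by linarith [(le_abs_self _).trans (hc x y)]⟩
  have h := (hasSubgaussianMGF_of_mem_Icc (μ := μ) hf.aemeasurable
    (Filter.Eventually.of_forall hmem)).mgf_le t
  refine h.trans (Real.exp_le_exp.2 (le_of_eq ?_))
  have : ‖(⨅ y, f y) + c - ⨅ y, f y‖ = c := by
    rw [add_sub_cancel_left, Real.norm_of_nonneg hc0]
  push_cast
  rw [this]
  ring

/-- The exponential-moment form of McDiarmid's bounded differences inequality, by induction on
the number of coordinates: given the others, the first coordinate is integrated out with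
Hoeffding's lemma, and the resulting conditional mean again has bounded differences. -/
theorem integral_exp_le_of_bounded_differences : ∀ {n : ℕ} (μ : Fin n → Measure Z)
    [∀ i, IsProbabilityMeasure (μ i)] {F : (Fin n → Z) → ℝ}, Measurable F → Bdd F →
    ∀ {c : Fin n → ℝ}, (∀ i z x, |F (Function.update z i x) - F z| ≤ c i) → ∀ t : ℝ,
    ∫ z, Real.exp (t * (F z - ∫ w, F w ∂Measure.pi μ)) ∂Measure.pi μ
      ≤ Real.exp (t ^ 2 * (∑ i, c i ^ 2) / 8) := by
  intro n
  induction n with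
  | zero =>
    intro μ _ F _ _ c _ t
    have : ∀ z : Fin 0 → Z, F z = F Fin.elim0 := fun z => congrArg F (Subsingleton.elim _ _)
    simp [this]
  | succ n ih =>
    intro μ _ F hF hb c hc t
    set ν := Measure.pi fun j : Fin n => μ j.succ with hν
    have hmp : MeasurePreserving (MeasurableEquiv.piFinSuccAbove (fun _ => Z) 0).symm
        ((μ 0).prod ν) (Measure.pi μ) := by
      have := (measurePreserving_piFinSuccAbove μ 0).symm
      simpa [hν] using this
    have hsymm : ∀ (x : Z) (w : Fin n → Z),
        (MeasurableEquiv.piFinSuccAbove (fun _ => Z) 0).symm (x, w)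
          = (Fin.cons x w : Fin (n + 1) → Z) := by
      intro x w
      simp [MeasurableEquiv.piFinSuccAbove, Fin.consEquiv]
    have hcons : Measurable fun p : Z × (Fin n → Z) => (Fin.cons p.1 p.2 : Fin (n + 1) → Z) := by
      have := (MeasurableEquiv.piFinSuccAbove (fun _ : Fin (n + 1) => Z) 0).symm.measurable
      convert! this using 1
      exact funext fun p => (hsymm p.1 p.2).symm
    have hint : ∀ {G : (Fin (n + 1) → Z) → ℝ}, Measurable G → Bdd G →
        ∫ z, G z ∂Measure.pi μ = ∫ w, ∫ x, G (Fin.cons x w) ∂μ 0 ∂ν := by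
      intro G hG hGb
      rw [← hmp.integral_comp', integral_prod_symm]
      · simp only [hsymm]
      · exact integrable_of_bdd (hG.comp (MeasurableEquiv.measurable _)) (hGb.comp _)
    obtain ⟨M, hM⟩ := hb
    have hF' : Measurable fun p : (Fin n → Z) × Z => F (Fin.cons p.2 p.1) :=
      hF.comp (hcons.comp measurable_swap)
    set H : (Fin n → Z) → ℝ := fun w => ∫ x, F (Fin.cons x w) ∂μ 0 with hH
    have hHm : Measurable H :=
      (hF'.stronglyMeasurable.integral_prod_right' (ν := μ 0)).measurable
    have hHM : ∀ w, |H w| ≤ M := fun w => abs_integral_le_of_abs_le fun x => hM _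
    have hFi : ∀ w, Integrable (fun x => F (Fin.cons x w)) (μ 0) := fun w =>
      integrable_of_bdd (hF'.comp measurable_prodMk_left) ⟨M, fun _ => hM _⟩
    have hHc : ∀ i w x, |H (Function.update w i x) - H w| ≤ c i.succ := by
      intro i w x
      rw [hH]
      simp only
      rw [← integral_sub (hFi _) (hFi _)]
      refine abs_integral_le_of_abs_le fun y => ?_
      rw [Fin.cons_update]
      exact hc i.succ _ x
    have hEF : ∫ w, F w ∂Measure.pi μ = ∫ w, H w ∂ν := hint hF ⟨M, hM⟩
    have hEM : |∫ w, H w ∂ν| ≤ M := abs_integral_le_of_abs_le hHM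
    have hexpb : ∀ s : ℝ, |s| ≤ M + M → |Real.exp (t * s)| ≤ Real.exp (|t| * (M + M)) := by
      intro s hs
      rw [abs_of_pos (Real.exp_pos _)]
      refine Real.exp_le_exp.2 ((le_abs_self _).trans ?_)
      rw [abs_mul]
      gcongr
    have hsub : ∀ a b : ℝ, |a| ≤ M → |b| ≤ M → |a - b| ≤ M + M := fun a b ha hb =>
      (abs_sub _ _).trans (add_le_add ha hb)
    rw [hEF, hint]
    rotate_left
    · exact Real.measurable_exp.comp ((hF.sub_const _).const_mul t)
    · exact ⟨_, fun z => hexpb _ (hsub _ _ (hM _) hEM)⟩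
    have hinner : ∀ w, ∫ x, Real.exp (t * (F (Fin.cons x w) - ∫ w, H w ∂ν)) ∂μ 0
        ≤ Real.exp (t ^ 2 * c 0 ^ 2 / 8) * Real.exp (t * (H w - ∫ w, H w ∂ν)) := by
      intro w
      have h1 : ∀ x, Real.exp (t * (F (Fin.cons x w) - ∫ w, H w ∂ν))
          = Real.exp (t * (F (Fin.cons x w) - H w)) * Real.exp (t * (H w - ∫ w, H w ∂ν)) := by
        intro x
        rw [← Real.exp_add]; ring_nf
      simp only [h1]
      rw [integral_mul_const]
      gcongr
      refine integral_exp_le_of_oscillation (hF'.comp measurable_prodMk_left) (fun x y => ?_) t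
      have := hc 0 (Fin.cons y w) x
      rwa [Fin.update_cons_zero] at this
    have hHe : Measurable fun w => Real.exp (t * (H w - ∫ w, H w ∂ν)) :=
      Real.measurable_exp.comp ((hHm.sub_const _).const_mul t)
    calc _ ≤ ∫ w, Real.exp (t ^ 2 * c 0 ^ 2 / 8) * Real.exp (t * (H w - ∫ w, H w ∂ν)) ∂ν := by
          refine integral_mono ?_ ?_ hinner
          · refine integrable_of_bdd ?_ ⟨_, fun w => abs_integral_le_of_abs_le fun x =>
              hexpb _ (hsub _ _ (hM _) hEM)⟩
            refine StronglyMeasurable.measurable ?_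
            exact (Real.measurable_exp.comp ((hF'.sub_const _).const_mul t)).stronglyMeasurable
              |>.integral_prod_right' (ν := μ 0)
          · exact (integrable_of_bdd hHe ⟨_, fun w => hexpb _ (hsub _ _ (hHM _) hEM)⟩).const_mul _
      _ ≤ Real.exp (t ^ 2 * c 0 ^ 2 / 8) * Real.exp (t ^ 2 * (∑ i : Fin n, c i.succ ^ 2) / 8) := by
          rw [integral_const_mul]
          gcongr
          exact ih (fun j => μ j.succ) hHm ⟨M, hHM⟩ hHc t
      _ = _ := by rw [← Real.exp_add, Fin.sum_univ_succ]; ring_nf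

/-- McDiarmid's bounded differences inequality: if changing the `i`-th coordinate changes `F` by
at most `c i`, and `∑ c i ^ 2 ≤ V`, then `F` exceeds its mean by at least `√(V u / 2)` with
probability at most `e ^ (-u)`. -/
theorem measureReal_ge_le_of_bounded_differences (μ : Fin n → Measure Z)
    [∀ i, IsProbabilityMeasure (μ i)] {F : (Fin n → Z) → ℝ} (hF : Measurable F) (hb : Bdd F)
    {c : Fin n → ℝ} (hc : ∀ i z x, |F (Function.update z i x) - F z| ≤ c i) {V u : ℝ}
    (hV : 0 < V) (hcV : ∑ i, c i ^ 2 ≤ V) (hu : 0 ≤ u) :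
    (Measure.pi μ).real {z | (∫ w, F w ∂Measure.pi μ) + Real.sqrt (V * u / 2) ≤ F z}
      ≤ Real.exp (-u) := by
  set E := ∫ w, F w ∂Measure.pi μ
  set s := Real.sqrt (V * u / 2)
  have hs2 : s ^ 2 = V * u / 2 := Real.sq_sqrt (by positivity)
  -- the optimal exponent in Chernoff's bound
  set t := 4 * s / V with ht
  have ht0 : 0 ≤ t := by positivity
  have hint : Integrable (fun z => Real.exp (t * (F z - E))) (Measure.pi μ) := by
    obtain ⟨M, hM⟩ := hb
    refine integrable_of_bdd (Real.measurable_exp.comp ((hF.sub_const _).const_mul t))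
      ⟨Real.exp (t * (M + |E|)), fun z => ?_⟩
    rw [abs_of_pos (Real.exp_pos _)]
    gcongr
    · linarith [(le_abs_self _).trans (hM z), neg_abs_le E]
  have h1 := measure_ge_le_exp_mul_mgf (μ := Measure.pi μ) (X := fun z => F z - E) s ht0 hint
  have h2 := integral_exp_le_of_bounded_differences μ hF hb hc t
  have h3 : {z | E + s ≤ F z} = {z | s ≤ F z - E} := by
    ext z; simp [le_sub_iff_add_le, add_comm]
  rw [h3]
  refine h1.trans ?_
  unfold mgf
  calc _ ≤ Real.exp (-t * s) * Real.exp (t ^ 2 * V / 8) := by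
        gcongr
        refine h2.trans (Real.exp_le_exp.2 ?_)
        gcongr
    _ = Real.exp (-u) := by
        rw [← Real.exp_add, ht]
        congr 1
        field_simp
        rw [hs2]; ring

/-- Symmetrization: the expected maximal deviation of sums of independent terms from their means
is at most twice the expected Rademacher average. -/
theorem integral_sup_deviation_le [Countable ι] [Nonempty ι] (μ : Fin n → Measure Z)
    [∀ i, IsProbabilityMeasure (μ i)] {F : ι → Fin n → Z → ℝ} (hF : ∀ t i, Measurable (F t i))
    {M : Fin n → ℝ} (hM : ∀ t i z, |F t i z| ≤ M i) :
    ∫ z, ⨆ t, ∑ i, ((∫ x, F t i x ∂μ i) - F t i (z i)) ∂Measure.pi μ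
      ≤ 2 * ∫ z, 𝔼 σ : Fin n → Bool, ⨆ t, ∑ i, sign (σ i) * F t i (z i) ∂Measure.pi μ := by
  have hFm : ∀ t i, Measurable fun z : Fin n → Z => F t i (z i) := fun t i =>
    (hF t i).comp (measurable_pi_apply i)
  -- `w i = (z i, z' i)` carries the sample and an independent copy of it
  set κ := Measure.pi fun i => (μ i).prod (μ i)
  let Q : (Fin n → Bool) → (Fin n → Z × Z) → ℝ := fun σ w =>
    ⨆ t, ∑ i, sign (σ i) * (F t i (w i).2 - F t i (w i).1)
  have hQb : ∀ (σ : Fin n → Bool) (w : Fin n → Z × Z) t,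
      |∑ i, sign (σ i) * (F t i (w i).2 - F t i (w i).1)| ≤ ∑ i, 2 * M i := by
    intro σ w t
    refine (Finset.abs_sum_le_sum_abs _ _).trans (Finset.sum_le_sum fun i _ => ?_)
    rw [abs_mul, abs_sign, one_mul, two_mul]
    exact (abs_sub _ _).trans (add_le_add (hM _ _ _) (hM _ _ _))
  have hQm : ∀ σ, Measurable (Q σ) := fun σ => by
    refine Measurable.iSup fun t => Finset.measurable_sum _ fun i _ => Measurable.const_mul ?_ _
    exact ((hF t i).comp (measurable_snd.comp (measurable_pi_apply i))).sub
      ((hF t i).comp (measurable_fst.comp (measurable_pi_apply i)))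
  have hQint : ∀ σ, Integrable (Q σ) κ := fun σ =>
    integrable_of_bdd (hQm σ) ⟨_, fun w => abs_ciSup_le (hQb σ w)⟩
  have hS : ∀ (σ : Fin n → Bool) (z : Fin n → Z) t, |∑ i, sign (σ i) * F t i (z i)| ≤ ∑ i, M i := by
    intro σ z t
    refine (Finset.abs_sum_le_sum_abs _ _).trans (Finset.sum_le_sum fun i _ => ?_)
    rw [abs_mul, abs_sign, one_mul]
    exact hM _ _ _
  have hSm : ∀ σ : Fin n → Bool,
      Measurable fun z : Fin n → Z => ⨆ t, ∑ i, sign (σ i) * F t i (z i) :=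
    fun σ => Measurable.iSup fun t => Finset.measurable_sum _ fun i _ => (hFm t i).const_mul _
  have hSint : ∀ σ : Fin n → Bool,
      Integrable (fun z : Fin n → Z => ⨆ t, ∑ i, sign (σ i) * F t i (z i)) (Measure.pi μ) :=
    fun σ => integrable_of_bdd (hSm σ) ⟨_, fun z => abs_ciSup_le (hS σ z)⟩
  have hfst : MeasurePreserving (fun (w : Fin n → Z × Z) i => (w i).1) κ (Measure.pi μ) :=
    measurePreserving_pi _ _ fun i => measurePreserving_fst
  have hsnd : MeasurePreserving (fun (w : Fin n → Z × Z) i => (w i).2) κ (Measure.pi μ) :=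
    measurePreserving_pi _ _ fun i => measurePreserving_snd
  -- exchanging the two copies in some coordinates does not change the law
  have hswap : ∀ σ, ∫ w, Q σ w ∂κ = ∫ w, Q (fun _ => true) w ∂κ := by
    intro σ
    have hmp : MeasurePreserving
        (fun (w : Fin n → Z × Z) i => if σ i = true then w i else (w i).swap) κ κ := by
      refine measurePreserving_pi (fun i => (μ i).prod (μ i)) (fun i => (μ i).prod (μ i))
        (f := fun i p => if σ i = true then p else p.swap) fun i => ?_
      by_cases h : σ i = true
      · simp only [h, if_true]; exact MeasurePreserving.id _
      · simp only [h]; exact Measure.measurePreserving_swap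
    rw [← integral_comp_of_measurePreserving hmp (hQm fun _ => true)]
    congr 1; ext w
    simp only [Q]
    congr 1; ext t
    refine Finset.sum_congr rfl fun i _ => ?_
    by_cases h : σ i = true <;> simp [h, sign]
  have hghost : ∫ z, ⨆ t, ∑ i, ((∫ x, F t i x ∂μ i) - F t i (z i)) ∂Measure.pi μ
      ≤ ∫ w, Q (fun _ => true) w ∂κ := by
    have hmp := measurePreserving_arrowProdEquivProdArrow Z Z (Fin n) μ μ
    rw [← hmp.symm.integral_comp', integral_prod]
    · refine integral_mono ?_ ?_ fun z => ?_
      · refine integrable_of_bdd (Measurable.iSup fun t => Finset.measurable_sum _ fun i _ =>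
          (hFm t i).const_sub _) ⟨∑ i, 2 * M i, fun z => abs_ciSup_le fun t => ?_⟩
        refine (Finset.abs_sum_le_sum_abs _ _).trans (Finset.sum_le_sum fun i _ => ?_)
        rw [two_mul]
        exact (abs_sub _ _).trans (add_le_add (abs_integral_le_of_abs_le (hM t i)) (hM _ _ _))
      · exact ((hmp.symm.integrable_comp_emb (MeasurableEquiv.measurableEmbedding _)).2
          (hQint _)).integral_prod_left
      · refine ciSup_le fun t => ?_
        have hi : Integrable (fun z' => Q (fun _ => true)
            ((MeasurableEquiv.arrowProdEquivProdArrow Z Z (Fin n)).symm (z, z'))) (Measure.pi μ) :=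
          integrable_of_bdd ((hQm _).comp ((MeasurableEquiv.measurable _).comp
            measurable_prodMk_left)) ⟨_, fun w => abs_ciSup_le (hQb _ _)⟩
        have hev : ∀ i, MeasurePreserving (Function.eval i) (Measure.pi μ) (μ i) :=
          fun i => measurePreserving_eval μ i
        have e : ∑ i, ((∫ x, F t i x ∂μ i) - F t i (z i))
            = ∫ z' : Fin n → Z, ∑ i, (F t i (z' i) - F t i (z i)) ∂Measure.pi μ := by
          rw [integral_finsetSum]
          · refine Finset.sum_congr rfl fun i _ => ?_
            rw [integral_sub _ (integrable_const _)]
            · rw [← integral_comp_of_measurePreserving (hev i) (hF t i)]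
              simp
            · exact integrable_of_bdd (hFm t i) ⟨M i, fun z => hM _ _ _⟩
          · intro i _
            exact (integrable_of_bdd (hFm t i) ⟨M i, fun z => hM _ _ _⟩).sub (integrable_const _)
        rw [e]
        refine integral_mono ?_ hi fun z' => ?_
        · exact integrable_finsetSum _ fun i _ =>
            (integrable_of_bdd (hFm t i) ⟨M i, fun z => hM _ _ _⟩).sub (integrable_const _)
        · have := Bdd.le_ciSup ⟨_, hQb (fun _ => true) fun i => (z i, z' i)⟩ t
          exact le_trans (le_of_eq (by simp [sign])) this
    · exact (hmp.symm.integrable_comp_emb (MeasurableEquiv.measurableEmbedding _)).2 (hQint _)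
  refine hghost.trans ?_
  have hav : ∫ w, Q (fun _ => true) w ∂κ = 𝔼 σ : Fin n → Bool, ∫ w, Q σ w ∂κ := by
    simp only [hswap]
    rw [Fintype.expect_const]
  have hexp : ∀ G : (Fin n → Bool) → (Fin n → Z) → ℝ, (∀ σ, Integrable (G σ) (Measure.pi μ)) →
      ∫ z, 𝔼 σ, G σ z ∂Measure.pi μ = 𝔼 σ, ∫ z, G σ z ∂Measure.pi μ := by
    intro G hG
    simp only [Finset.expect_eq_sum_div_card]
    rw [integral_div, integral_finsetSum _ fun σ _ => hG σ]
  rw [hav, hexp _ hSint, two_mul]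
  -- negating all signs
  have hneg : 𝔼 σ : Fin n → Bool, ∫ z, ⨆ t, ∑ i, sign (σ i) * F t i (z i) ∂Measure.pi μ
      = 𝔼 σ : Fin n → Bool, ∫ z, ⨆ t, ∑ i, sign (!(σ i)) * F t i (z i) ∂Measure.pi μ :=
    (Fintype.expect_equiv (Function.Involutive.toPerm (fun (σ : Fin n → Bool) i => !(σ i))
      fun σ => by simp) _ _ fun _ => rfl).symm
  nth_rw 2 [hneg]
  rw [← Finset.expect_add_distrib]
  refine Finset.expect_le_expect fun σ _ => ?_
  rw [← integral_comp_of_measurePreserving hsnd (hSm σ),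
    ← integral_comp_of_measurePreserving hfst (hSm fun i => !(σ i)),
    ← integral_add]
  · refine integral_mono (hQint σ) (Integrable.add ?_ ?_) fun w => ciSup_le fun t => ?_
    · exact hsnd.integrable_comp_of_integrable (hSint σ)
    · exact hfst.integrable_comp_of_integrable (hSint fun i => !(σ i))
    · have h1 := Bdd.le_ciSup ⟨_, hS σ fun i => (w i).2⟩ t
      have h2 := Bdd.le_ciSup ⟨_, hS (fun i => !(σ i)) fun i => (w i).1⟩ t
      refine le_trans (le_of_eq ?_) (add_le_add h1 h2)
      rw [← Finset.sum_add_distrib]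
      exact Finset.sum_congr rfl fun i _ => by rw [sign_not]; ring
  · exact hsnd.integrable_comp_of_integrable (hSint σ)
  · exact hfst.integrable_comp_of_integrable (hSint fun i => !(σ i))

/-- Conditioning a product measure on a box of positive measure conditions every factor. -/
theorem cond_pi (μ : Fin n → Measure Z) [∀ i, IsProbabilityMeasure (μ i)] {B : Fin n → Set Z}
    (hB : ∀ i, MeasurableSet (B i)) (h : ∀ i, μ i (B i) ≠ 0) :
    (Measure.pi μ)[|Set.univ.pi B] = Measure.pi fun i => (μ i)[|B i] := by
  have : ∀ i, IsProbabilityMeasure ((μ i)[|B i]) := fun i => cond_isProbabilityMeasure (h i)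
  symm
  refine Measure.pi_eq fun S hS => ?_
  rw [cond_apply (MeasurableSet.univ_pi hB), ← Set.pi_inter_distrib, Measure.pi_pi, Measure.pi_pi]
  simp only [cond_apply (hB _)]
  rw [Finset.prod_mul_distrib, ENNReal.prod_inv_distrib]
  intro i _ j _ _
  exact Or.inr (measure_ne_top _ _)

/-- A function that depends only on the coordinates in `A` has the same integral under two product
measures with the same factors in `A`. -/
theorem integral_pi_congr (μ ν : Fin n → Measure Z) [∀ i, IsProbabilityMeasure (μ i)]
    [∀ i, IsProbabilityMeasure (ν i)] {A : Finset (Fin n)} (h : ∀ i ∈ A, μ i = ν i)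
    {G : (Fin n → Z) → ℝ} (hG : Measurable G)
    (hGA : ∀ z z', (∀ i ∈ A, z i = z' i) → G z = G z') :
    ∫ z, G z ∂Measure.pi μ = ∫ z, G z ∂Measure.pi ν := by
  have hfst : MeasurePreserving (fun (w : Fin n → Z × Z) i => (w i).1)
      (Measure.pi fun i => (μ i).prod (ν i)) (Measure.pi μ) :=
    measurePreserving_pi _ _ fun i => measurePreserving_fst
  have hmix : MeasurePreserving (fun (w : Fin n → Z × Z) i => if i ∈ A then (w i).1 else (w i).2)
      (Measure.pi fun i => (μ i).prod (ν i)) (Measure.pi ν) := by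
    refine measurePreserving_pi (fun i => (μ i).prod (ν i)) ν
      (f := fun i p => if i ∈ A then p.1 else p.2) fun i => ?_
    by_cases hi : i ∈ A
    · simp only [hi, if_true]; rw [← h i hi]; exact measurePreserving_fst
    · simp only [hi, if_false]; exact measurePreserving_snd
  rw [← integral_comp_of_measurePreserving hfst hG,
    ← integral_comp_of_measurePreserving hmix hG]
  congr 1; ext w
  exact hGA _ _ fun i hi => by simp [hi]

end Tools

/-! ### Rademacher averages over parts of a sample -/

section ClassRad

variable {Z ι J : Type*} {n : ℕ}

/-- The values of a class of vector-valued functions on the part `A` of a sample, and `0` outside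
`A`. -/
def restrictTo (φ : ι → Z → J → ℝ) (A : Finset (Fin n)) (z : Fin n → Z) : ι → Fin n → J → ℝ :=
  fun t i j => if i ∈ A then φ t (z i) j else 0

theorem abs_restrictTo_le {φ : ι → Z → J → ℝ} {M : ℝ} (hM : ∀ t z j, |φ t z j| ≤ M)
    (A : Finset (Fin n)) (z : Fin n → Z) (t : ι) (i : Fin n) (j : J) :
    |restrictTo φ A z t i j| ≤ if i ∈ A then M else 0 := by
  by_cases hi : i ∈ A <;> simp [restrictTo, hi, hM]

theorem bdd_restrictTo {φ : ι → Z → J → ℝ} {M : ℝ} (hM : ∀ t z j, |φ t z j| ≤ M)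
    (A : Finset (Fin n)) (z : Fin n → Z) (i : Fin n) (j : J) :
    Bdd fun t => restrictTo φ A z t i j :=
  ⟨_, fun t => abs_restrictTo_le hM A z t i j⟩

variable [Fintype J] [DecidableEq J]

theorem rad_restrictTo_congr (φ : ι → Z → J → ℝ) {A : Finset (Fin n)} {z z' : Fin n → Z}
    (h : ∀ i ∈ A, z i = z' i) : rad (restrictTo φ A z) = rad (restrictTo φ A z') := by
  congr 1
  ext t i j
  by_cases hi : i ∈ A <;> simp [restrictTo, hi, h]

theorem abs_rad_restrictTo_le [Nonempty ι] {φ : ι → Z → J → ℝ} {M : ℝ}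
    (hM : ∀ t z j, |φ t z j| ≤ M) (A : Finset (Fin n)) (z : Fin n → Z) :
    |rad (restrictTo φ A z)| ≤ A.card * (Fintype.card J * M) := by
  refine (abs_rad_le (abs_restrictTo_le hM A z)).trans (le_of_eq ?_)
  simp [Finset.sum_ite_mem]

theorem rad_restrictTo_mono [Nonempty ι] {φ : ι → Z → J → ℝ} {M : ℝ}
    (hM : ∀ t z j, |φ t z j| ≤ M) {A B : Finset (Fin n)} (h : A ⊆ B) (z : Fin n → Z) :
    rad (restrictTo φ A z) ≤ rad (restrictTo φ B z) := by
  refine le_trans (le_of_eq ?_) (rad_restrict_le (bdd_restrictTo hM B z) fun i _ => i ∈ A)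
  congr 1
  ext t i j
  by_cases hi : i ∈ A <;> simp [restrictTo, hi]
  exact fun hB => absurd (h hi) hB

variable [MeasurableSpace Z]

theorem measurable_rad_restrictTo [Countable ι] {φ : ι → Z → J → ℝ}
    (hφ : ∀ t j, Measurable fun z => φ t z j) (A : Finset (Fin n)) :
    Measurable fun z : Fin n → Z => rad (restrictTo φ A z) := by
  simp only [rad, Finset.expect_eq_sum_div_card]
  refine Measurable.div_const (Finset.measurable_sum _ fun σ _ => Measurable.iSup fun t => ?_) _
  refine Finset.measurable_sum _ fun i _ => Finset.measurable_sum _ fun j _ =>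
    Measurable.const_mul ?_ _
  by_cases hi : i ∈ A
  · simp only [restrictTo, hi, if_true]
    exact (hφ t j).comp (measurable_pi_apply i)
  · simp [restrictTo, hi]

/-- The expected Rademacher average over the part `A` of a sample of independent points with
law `ν`. -/
def partRad (φ : ι → Z → J → ℝ) (ν : Measure Z) (A : Finset (Fin n)) : ℝ :=
  ∫ z, rad (restrictTo φ A z) ∂Measure.pi fun _ => ν

variable {φ : ι → Z → J → ℝ} {M : ℝ} {ν : Measure Z}

theorem partRad_nonneg [Nonempty ι] (hM : ∀ t z j, |φ t z j| ≤ M) (A : Finset (Fin n)) :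
    0 ≤ partRad φ ν A :=
  integral_nonneg fun z => rad_nonneg (bdd_restrictTo hM A z)

variable [IsProbabilityMeasure ν]

theorem partRad_le [Nonempty ι] (hM : ∀ t z j, |φ t z j| ≤ M) (A : Finset (Fin n)) :
    partRad φ ν A ≤ A.card * (Fintype.card J * M) :=
  (le_abs_self _).trans (abs_integral_le_of_abs_le (abs_rad_restrictTo_le hM A))

variable [Countable ι]

/-- Since the points are identically distributed, only the size of the part matters. -/
theorem partRad_eq_of_card_eq (hφ : ∀ t j, Measurable fun z => φ t z j) {A B : Finset (Fin n)}
    (h : A.card = B.card) : partRad φ ν A = partRad φ ν B := by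
  classical
  set e : Equiv.Perm (Fin n) := (Finset.equivOfCardEq h).extendSubtype
  have hmem : ∀ i, e i ∈ B ↔ i ∈ A := fun i => by
    constructor
    · intro hi
      by_contra hA
      exact Equiv.extendSubtype_not_mem (Finset.equivOfCardEq h) i hA hi
    · exact fun hi => Equiv.extendSubtype_mem (Finset.equivOfCardEq h) i hi
  have hmp : MeasurePreserving (fun (z : Fin n → Z) i => z (e i)) (Measure.pi fun _ => ν)
      (Measure.pi fun _ => ν) := by
    convert! measurePreserving_piCongrLeft (α := fun _ : Fin n => Z) (fun _ => ν) e.symm using 1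
    ext z i
    simp [MeasurableEquiv.coe_piCongrLeft, Equiv.piCongrLeft_apply]
  unfold partRad
  rw [← integral_comp_of_measurePreserving hmp (measurable_rad_restrictTo hφ A)]
  congr 1; ext z
  rw [← rad_comp_perm e (restrictTo φ B z)]
  congr 1; ext t i j
  simp [restrictTo, hmem]

variable [Nonempty ι]

theorem integrable_rad_restrictTo (hφ : ∀ t j, Measurable fun z => φ t z j)
    (hM : ∀ t z j, |φ t z j| ≤ M) (A : Finset (Fin n)) (P : Measure (Fin n → Z))
    [IsFiniteMeasure P] : Integrable (fun z => rad (restrictTo φ A z)) P :=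
  integrable_of_bdd (measurable_rad_restrictTo hφ A) ⟨_, abs_rad_restrictTo_le hM A⟩

theorem partRad_mono (hφ : ∀ t j, Measurable fun z => φ t z j) (hM : ∀ t z j, |φ t z j| ≤ M)
    {A B : Finset (Fin n)} (h : A ⊆ B) : partRad φ ν A ≤ partRad φ ν B :=
  integral_mono (integrable_rad_restrictTo hφ hM A _) (integrable_rad_restrictTo hφ hM B _)
    (rad_restrictTo_mono hM h)

theorem partRad_union_le (hφ : ∀ t j, Measurable fun z => φ t z j) (hM : ∀ t z j, |φ t z j| ≤ M)
    {A B : Finset (Fin n)} (h : Disjoint A B) :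
    partRad φ ν (A ∪ B) ≤ partRad φ ν A + partRad φ ν B := by
  unfold partRad
  rw [← integral_add (integrable_rad_restrictTo hφ hM A _) (integrable_rad_restrictTo hφ hM B _)]
  refine integral_mono (integrable_rad_restrictTo hφ hM _ _)
    ((integrable_rad_restrictTo hφ hM A _).add (integrable_rad_restrictTo hφ hM B _)) fun z => ?_
  refine le_trans (le_of_eq ?_) (rad_add_le (bdd_restrictTo hM A z) (bdd_restrictTo hM B z))
  congr 1
  ext t i j
  have := fun hA : i ∈ A => Finset.disjoint_left.1 h hA
  by_cases hA : i ∈ A <;> by_cases hB : i ∈ B <;> simp_all [restrictTo]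

/-- Monotonicity and subadditivity bound the Rademacher average over a part by the one over
any other part, up to the ratio of the sizes. -/
theorem card_mul_partRad_le (hφ : ∀ t j, Measurable fun z => φ t z j)
    (hM : ∀ t z j, |φ t z j| ≤ M) (B : Finset (Fin n)) : ∀ A : Finset (Fin n),
    (B.card : ℝ) * partRad φ ν A ≤ (A.card + B.card) * partRad φ ν B := by
  suffices h : ∀ k, ∀ A : Finset (Fin n), A.card = k →
      (B.card : ℝ) * partRad φ ν A ≤ (A.card + B.card) * partRad φ ν B from fun A => h _ A rfl
  have hB0 := partRad_nonneg (ν := ν) hM B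
  intro k
  induction k using Nat.strong_induction_on with
  | _ k ih =>
    intro A hA
    rcases le_or_gt A.card B.card with hAB | hAB
    · obtain ⟨B', hB', hc⟩ := Finset.exists_subset_card_eq hAB
      have h1 : partRad φ ν A ≤ partRad φ ν B :=
        (partRad_eq_of_card_eq hφ hc.symm).le.trans (partRad_mono hφ hM hB')
      calc (B.card : ℝ) * partRad φ ν A ≤ B.card * partRad φ ν B := by gcongr
        _ ≤ (A.card + B.card) * partRad φ ν B := by
          gcongr; linarith [Nat.cast_nonneg (α := ℝ) A.card]
    · rcases Nat.eq_zero_or_pos B.card with h0 | hpos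
      · rw [h0]; simp; positivity
      obtain ⟨A', hA', hc⟩ := Finset.exists_subset_card_eq hAB.le
      have hcard : (A \ A').card = A.card - B.card := by
        rw [Finset.card_sdiff_of_subset hA', hc]
      have h1 := ih (A \ A').card (by omega) (A \ A') rfl
      have h2 := partRad_union_le (ν := ν) hφ hM (Finset.disjoint_sdiff (s := A') (t := A))
      rw [Finset.union_sdiff_of_subset hA', partRad_eq_of_card_eq hφ hc] at h2
      rw [hcard, Nat.cast_sub hAB.le] at h1
      have h3 : (B.card : ℝ) * partRad φ ν A
          ≤ B.card * (partRad φ ν B + partRad φ ν (A \ A')) := by gcongr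
      nlinarith

end ClassRad

section Counting

variable {Z : Type*} {n : ℕ}

open Classical in
/-- The indices of the points of a sample that lie in `B`. -/
def hits (B : Set Z) (z : Fin n → Z) : Finset (Fin n) := Finset.univ.filter fun i => z i ∈ B

theorem card_hits (B : Set Z) (z : Fin n → Z) :
    ((hits B z).card : ℝ) = ∑ i, B.indicator 1 (z i) := by
  classical
  simp [hits, Set.indicator_apply]

theorem card_hits_le (B : Set Z) (z : Fin n → Z) : ((hits B z).card : ℝ) ≤ n := by
  exact_mod_cast (Finset.card_le_univ _).trans (by simp)

variable [MeasurableSpace Z]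

theorem measurable_card_hits {B : Set Z} (hB : MeasurableSet B) :
    Measurable fun z : Fin n → Z => ((hits B z).card : ℝ) := by
  simp only [card_hits]
  exact Finset.measurable_sum _ fun i _ =>
    (measurable_one.indicator hB).comp (measurable_pi_apply i)

/-- The exponential moments of a binomial variable, bounded by those of a Poisson variable with
the same mean. -/
theorem integral_exp_card_hits_le (ν : Measure Z) [IsProbabilityMeasure ν] {B : Set Z}
    (hB : MeasurableSet B) (s : ℝ) :
    ∫ z : Fin n → Z, Real.exp (s * (hits B z).card) ∂(Measure.pi fun _ => ν)
      ≤ Real.exp (n * ν.real B * (Real.exp s - 1)) := by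
  have h1 : ∀ z : Fin n → Z, Real.exp (s * (hits B z).card)
      = ∏ i, Real.exp (s * B.indicator 1 (z i)) := fun z => by
    rw [card_hits, Finset.mul_sum, Real.exp_sum]
  have h2 : ∀ x, Real.exp (s * B.indicator 1 x)
      = 1 + B.indicator 1 x * (Real.exp s - 1) := fun x => by
    by_cases hx : x ∈ B <;> simp [hx]
  simp only [h1]
  rw [integral_fintype_prod_eq_pow (fun x => Real.exp (s * B.indicator 1 x))]
  have hi : Integrable (B.indicator (1 : Z → ℝ)) ν := (integrable_const 1).indicator hB
  have h3 : ∫ x, Real.exp (s * B.indicator 1 x) ∂ν = 1 + ν.real B * (Real.exp s - 1) := by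
    simp only [h2]
    rw [integral_add (integrable_const _) (hi.mul_const _), integral_mul_const,
      integral_indicator_one hB]
    simp
  have h4 : 0 ≤ 1 + ν.real B * (Real.exp s - 1) := by
    rw [← h3]; exact integral_nonneg fun x => (Real.exp_pos _).le
  rw [h3, Fintype.card_fin, mul_assoc, Real.exp_nat_mul]
  gcongr
  linarith [Real.add_one_le_exp (ν.real B * (Real.exp s - 1))]

/-- A binomial variable exceeds twice its mean plus `u` with probability at most `e ^ (-u)`. -/
theorem measureReal_card_hits_ge_le (ν : Measure Z) [IsProbabilityMeasure ν] {B : Set Z}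
    (hB : MeasurableSet B) (u : ℝ) :
    (Measure.pi fun _ : Fin n => ν).real {z | 2 * (n * ν.real B) + u ≤ (hits B z).card}
      ≤ Real.exp (-u) := by
  have hint : Integrable (fun z : Fin n → Z => Real.exp (1 * ((hits B z).card : ℝ)))
      (Measure.pi fun _ => ν) := by
    refine integrable_of_bdd (Real.measurable_exp.comp ((measurable_card_hits hB).const_mul 1))
      ⟨Real.exp (1 * n), fun z => ?_⟩
    rw [abs_of_pos (Real.exp_pos _)]
    exact Real.exp_le_exp.2 (mul_le_mul_of_nonneg_left (card_hits_le B z) zero_le_one)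
  refine (measure_ge_le_exp_mul_mgf _ zero_le_one hint).trans ?_
  unfold mgf
  refine (mul_le_mul_of_nonneg_left (integral_exp_card_hits_le ν hB 1)
    (Real.exp_pos _).le).trans ?_
  rw [← Real.exp_add]
  refine Real.exp_le_exp.2 ?_
  have h : 0 ≤ n * ν.real B := by positivity
  nlinarith [Real.exp_one_lt_d9]

/-- The lower tail of a binomial variable. -/
theorem measureReal_card_hits_le_le (ν : Measure Z) [IsProbabilityMeasure ν] {B : Set Z}
    (hB : MeasurableSet B) (hn : 0 < n) {u : ℝ} (hu : 0 ≤ u) :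
    (Measure.pi fun _ : Fin n => ν).real
        {z | (hits B z).card + Real.sqrt (n * u / 2) ≤ n * ν.real B} ≤ Real.exp (-u) := by
  have hm : Measurable fun z : Fin n → Z => -((hits B z).card : ℝ) := (measurable_card_hits hB).neg
  have hE : ∫ z : Fin n → Z, -((hits B z).card : ℝ) ∂(Measure.pi fun _ => ν)
      = -(n * ν.real B) := by
    rw [integral_neg]
    simp only [card_hits]
    rw [integral_finsetSum]
    · have : ∀ i : Fin n, ∫ z : Fin n → Z, B.indicator (1 : Z → ℝ) (z i) ∂(Measure.pi fun _ => ν)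
          = ν.real B := fun i => by
        rw [← integral_indicator_one hB]
        exact integral_comp_of_measurePreserving (measurePreserving_eval (fun _ => ν) i)
          (measurable_one.indicator hB)
      simp [this]
    · exact fun i _ => integrable_of_bdd
        ((measurable_one.indicator hB).comp (measurable_pi_apply i))
        ⟨1, fun z => by by_cases h : z i ∈ B <;> simp [h]⟩
  have h := measureReal_ge_le_of_bounded_differences (fun _ : Fin n => ν) hm
    ⟨n, fun z => by rw [abs_neg, Nat.abs_cast]; exact (card_hits_le B z :)⟩ (c := fun _ => 1) ?_
    (V := n) (by exact_mod_cast hn) (by simp) hu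
  · refine le_trans (le_of_eq ?_) h
    rw [hE]
    congr 1; ext z
    simp only [Set.mem_ofPred_eq]
    constructor <;> intro h <;> linarith
  · intro i z x
    have : ∀ w : Fin n → Z, ((hits B w).card : ℝ)
        = B.indicator 1 (w i) + ∑ j ∈ Finset.univ.erase i, B.indicator 1 (w j) := fun w => by
      rw [card_hits, Finset.add_sum_erase _ (fun j => B.indicator 1 (w j)) (Finset.mem_univ i)]
    rw [this, this z]
    have e : ∑ j ∈ Finset.univ.erase i, B.indicator (1 : Z → ℝ) (Function.update z i x j)
        = ∑ j ∈ Finset.univ.erase i, B.indicator 1 (z j) :=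
      Finset.sum_congr rfl fun j hj => by
        rw [Function.update_of_ne (Finset.ne_of_mem_erase hj)]
    rw [e, Function.update_self]
    by_cases h1 : x ∈ B <;> by_cases h2 : z i ∈ B <;> simp [h1, h2]

variable {ι J : Type*} [Fintype J] [DecidableEq J] [Countable ι] [Nonempty ι] {φ : ι → Z → J → ℝ}
  {M : ℝ}

/-- The expected Rademacher average of a full sample dominates the one over a part with points
drawn from a conditional law, when the size of the part is comparable with the expected number
of sample points that the full sample has in the conditioning event. -/
theorem partRad_cond_mul_le (hφ : ∀ t j, Measurable fun z => φ t z j)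
    (hM : ∀ t z j, |φ t z j| ≤ M) (ν : Measure Z) [IsProbabilityMeasure ν] {B : Set Z}
    (hB : MeasurableSet B) (hνB : ν B ≠ 0) (A : Finset (Fin n)) {a : ℝ} (ha : 0 < a)
    (hA : A.card ≤ a) :
    partRad φ (ν[|B]) A * ((1 - Real.exp (-(n * ν.real B / (a + 1)))) / 2)
      ≤ partRad φ ν (Finset.univ : Finset (Fin n)) := by
  classical
  have : IsProbabilityMeasure (ν[|B]) := cond_isProbabilityMeasure hνB
  set S := partRad φ (ν[|B]) A with hS
  have hS0 : 0 ≤ S := partRad_nonneg hM A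
  set P := Measure.pi fun _ : Fin n => ν with hP
  -- the size of the part weighted against the number of hits
  let g : ℕ → ℝ := fun k => S * ((1 - Real.exp (-(1 / a) * k)) / 2)
  have hg : ∀ I : Finset (Fin n), g I.card ≤ partRad φ (ν[|B]) I := by
    intro I
    have h1 := card_mul_partRad_le (ν := ν[|B]) hφ hM I A
    have h0 := partRad_nonneg (ν := ν[|B]) hM I
    have hI : (0 : ℝ) ≤ I.card := Nat.cast_nonneg _
    have h2 : (I.card : ℝ) * S ≤ (a + I.card) * partRad φ (ν[|B]) I :=
      h1.trans (by gcongr)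
    -- `(1 - e^{-x}) / 2 ≤ min x 1 / 2 ≤ x / (1 + x)` for `x = k / a`
    have h3 : (1 - Real.exp (-(1 / a) * I.card)) / 2 ≤ I.card / (a + I.card) := by
      rw [div_le_div_iff₀ two_pos (by positivity)]
      have e1 : 1 - Real.exp (-(1 / a) * I.card) ≤ I.card / a := by
        have := Real.add_one_le_exp (-(1 / a) * (I.card : ℝ))
        have e : -(1 / a) * (I.card : ℝ) = -(I.card / a) := by ring
        rw [e] at this ⊢
        linarith
      have e2 : 1 - Real.exp (-(1 / a) * I.card) ≤ 1 := by
        linarith [Real.exp_pos (-(1 / a) * I.card)]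
      have e3 : (1 - Real.exp (-(1 / a) * I.card)) * a ≤ I.card := by
        rwa [le_div_iff₀ ha] at e1
      have e4 := mul_le_mul_of_nonneg_right e2 hI
      nlinarith
    calc g I.card ≤ S * (I.card / (a + I.card)) := by simp only [g]; gcongr
      _ = (I.card * S) / (a + I.card) := by ring
      _ ≤ _ := by rw [div_le_iff₀ (by positivity)]; linarith
  -- split according to the set of indices that hit `B`
  let fib : Finset (Fin n) → Set (Fin n → Z) := fun I =>
    Set.univ.pi fun i => if i ∈ I then B else Bᶜ
  have hfm : ∀ I, MeasurableSet (fib I) := fun I => MeasurableSet.univ_pi fun i => by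
    by_cases hi : i ∈ I <;> simp [hi, hB, hB.compl]
  have hfib : ∀ I z, z ∈ fib I ↔ hits B z = I := by
    intro I z
    simp only [fib, Set.mem_univ_pi, hits, Finset.ext_iff, Finset.mem_filter, Finset.mem_univ,
      true_and]
    refine forall_congr' fun i => ?_
    by_cases hi : i ∈ I <;> simp [hi]
  have hsplit : ∀ {G : (Fin n → Z) → ℝ}, Integrable G P →
      ∫ z, G z ∂P = ∑ I, ∫ z in fib I, G z ∂P := by
    intro G hG
    rw [← integral_iUnion_fintype hfm _ fun I => hG.integrableOn]
    · have : ⋃ I, fib I = Set.univ := Set.eq_univ_of_forall fun z =>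
        Set.mem_iUnion.2 ⟨hits B z, (hfib _ _).2 rfl⟩
      rw [this, setIntegral_univ]
    · intro I I' hne
      refine Set.disjoint_left.2 fun z h h' => hne ?_
      rw [← (hfib _ _).1 h, ← (hfib _ _).1 h']
  have hexpb : ∀ z : Fin n → Z, |Real.exp (-(1 / a) * (hits B z).card)| ≤ 1 := fun z => by
    rw [abs_of_pos (Real.exp_pos _)]
    refine Real.exp_le_one_iff.2 ?_
    rw [neg_mul, neg_nonpos]; positivity
  have hexpi : Integrable (fun z : Fin n → Z => Real.exp (-(1 / a) * (hits B z).card)) P :=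
    integrable_of_bdd (Real.measurable_exp.comp ((measurable_card_hits hB).const_mul _)) ⟨1, hexpb⟩
  have hgi : Integrable (fun z : Fin n → Z => g (hits B z).card) P :=
    (((integrable_const 1).sub hexpi).div_const 2).const_mul S
  have h1 : ∫ z, g (hits B z).card ∂P ≤ partRad φ ν (Finset.univ : Finset (Fin n)) := by
    have hRi := integrable_rad_restrictTo hφ hM (Finset.univ : Finset (Fin n)) P
    unfold partRad
    rw [hsplit hgi, hsplit hRi]
    refine Finset.sum_le_sum fun I _ => ?_
    rcases eq_or_ne (P (fib I)) 0 with h0 | h0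
    · rw [setIntegral_measure_zero _ h0, setIntegral_measure_zero _ h0]
    have hi0 : ∀ i, ν (if i ∈ I then B else Bᶜ) ≠ 0 := by
      intro i hi
      apply h0
      simp only [hP, fib, Measure.pi_pi]
      exact Finset.prod_eq_zero (Finset.mem_univ i) hi
    have hcond : P[|fib I] = Measure.pi fun i => ν[|if i ∈ I then B else Bᶜ] :=
      cond_pi (fun _ => ν) (fun i => by by_cases hi : i ∈ I <;> simp [hi, hB, hB.compl]) hi0
    have hpr : ∀ i, IsProbabilityMeasure (ν[|if i ∈ I then B else Bᶜ]) :=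
      fun i => cond_isProbabilityMeasure (hi0 i)
    have hpart : ∫ z in fib I, rad (restrictTo φ I z) ∂P
        = P.real (fib I) * partRad φ (ν[|B]) I := by
      unfold partRad
      rw [← integral_pi_congr (fun i => ν[|if i ∈ I then B else Bᶜ]) (fun _ => ν[|B]) (A := I)
        (fun i hi => by simp [hi]) (measurable_rad_restrictTo hφ I)
        (fun z z' h => rad_restrictTo_congr φ h), ← hcond, ProbabilityTheory.cond,
        integral_smul_measure, smul_eq_mul, ← mul_assoc, ENNReal.toReal_inv, measureReal_def,
        mul_inv_cancel₀ (ENNReal.toReal_ne_zero.2 ⟨h0, measure_ne_top _ _⟩), one_mul]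
    calc ∫ z in fib I, g (hits B z).card ∂P = ∫ z in fib I, g I.card ∂P :=
          setIntegral_congr_fun (hfm I) fun z hz => by simp only [(hfib _ _).1 hz]
      _ = P.real (fib I) * g I.card := by simp
      _ ≤ P.real (fib I) * partRad φ (ν[|B]) I := by gcongr; exact hg I
      _ = ∫ z in fib I, rad (restrictTo φ I z) ∂P := hpart.symm
      _ ≤ _ := integral_mono (integrable_rad_restrictTo hφ hM I _)
          (integrable_rad_restrictTo hφ hM Finset.univ _)
          (rad_restrictTo_mono hM (Finset.subset_univ I))
  refine le_trans ?_ h1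
  simp only [g]
  rw [integral_const_mul, integral_div, integral_sub (integrable_const _) hexpi]
  simp only [integral_const, probReal_univ, one_smul]
  gcongr
  refine (integral_exp_card_hits_le ν hB _).trans (Real.exp_le_exp.2 ?_)
  -- `e^{-1/a} - 1 ≤ -1 / (a + 1)`
  have e : Real.exp (-(1 / a)) - 1 ≤ -(1 / (a + 1)) := by
    have h := Real.add_one_le_exp (1 / a)
    rw [Real.exp_neg]
    have h2 : (Real.exp (1 / a))⁻¹ ≤ (1 / a + 1)⁻¹ := inv_anti₀ (by positivity) h
    have h3 : (1 / a + 1)⁻¹ = 1 - 1 / (a + 1) := by field_simp; ring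
    linarith
  have h4 := mul_le_mul_of_nonneg_left e (show 0 ≤ n * ν.real B by positivity)
  refine h4.trans (le_of_eq ?_)
  ring

/-- If the size of a part is at most twice the expected number of hits plus `u`, the Rademacher
average over the part is bounded by the full one, up to a term linear in `u`. -/
theorem partRad_cond_le (hφ : ∀ t j, Measurable fun z => φ t z j)
    (hM : ∀ t z j, |φ t z j| ≤ M) (hM0 : 0 ≤ M) (ν : Measure Z) [IsProbabilityMeasure ν] {B : Set Z}
    (hB : MeasurableSet B) (hνB : ν B ≠ 0) (A : Finset (Fin n)) {u : ℝ} (hu : 0 ≤ u)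
    (hA : A.card ≤ 2 * (n * ν.real B) + u) :
    partRad φ (ν[|B]) A ≤ 10 * partRad φ ν (Finset.univ : Finset (Fin n))
      + (3 * u + 2) * (Fintype.card J * M) := by
  have : IsProbabilityMeasure (ν[|B]) := cond_isProbabilityMeasure hνB
  have hR := partRad_nonneg (ν := ν) hM (Finset.univ : Finset (Fin n))
  have hJM : 0 ≤ Fintype.card J * M := by positivity
  set q := n * ν.real B with hq
  rcases lt_or_ge q (u + 1) with h | h
  · -- few expected hits: the trivial bound
    have h1 := partRad_le (ν := ν[|B]) hM A
    have h2 : (A.card : ℝ) * (Fintype.card J * M) ≤ (3 * u + 2) * (Fintype.card J * M) := by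
      gcongr; linarith
    linarith
  · have h1 := partRad_cond_mul_le hφ hM ν hB hνB A (a := 3 * q) (by linarith) (by linarith)
    have hS := partRad_nonneg (ν := ν[|B]) hM A
    have h2 : Real.exp (-(q / (3 * q + 1))) ≤ 4 / 5 := by
      have e1 : 1 / 4 ≤ q / (3 * q + 1) := by
        rw [div_le_div_iff₀ (by norm_num) (by linarith)]; linarith
      have e2 := Real.add_one_le_exp (1 / 4 : ℝ)
      have e3 := Real.exp_le_exp.2 e1
      rw [Real.exp_neg, inv_le_comm₀ (Real.exp_pos _) (by norm_num)]
      rw [show ((4 / 5 : ℝ))⁻¹ = 5 / 4 by norm_num]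
      linarith
    have h3 : partRad φ (ν[|B]) A * (1 / 10)
        ≤ partRad φ (ν[|B]) A * ((1 - Real.exp (-(q / (3 * q + 1)))) / 2) := by
      exact mul_le_mul_of_nonneg_left (by linarith) hS
    have h4 : 0 ≤ (3 * u + 2) * (Fintype.card J * M) := by positivity
    linarith

end Counting

/-! ### The deviation given the labels, and the weights -/

section Conditional

variable {X ι : Type*} [MeasurableSpace X] {C n m : ℕ}

/-- The standing assumptions on a class of models `φ` and its losses `ℓ`: everything is measurable
and bounded, and the loss of a sample is a Lipschitz function of the model output for the maximum
norm. -/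
structure IsLossClass (ℓ : ι → X → Fin C → ℝ) (φ : ι → X → Fin C → ℝ) (B M Λ : ℝ) : Prop where
  measurable_loss : ∀ t y, Measurable fun x => ℓ t x y
  measurable_model : ∀ t j, Measurable fun x => φ t x j
  loss_nonneg : ∀ t x y, 0 ≤ ℓ t x y
  loss_le : ∀ t x y, ℓ t x y ≤ B
  abs_model_le : ∀ t x j, |φ t x j| ≤ M
  lipschitz : ∀ t t' x y, |ℓ t x y - ℓ t' x y| ≤ Λ * ‖φ t x - φ t' x‖

/-- The pairs with label `c`. -/
def classSet (X : Type*) {C : ℕ} (c : Fin C) : Set (X × Fin C) := {z | z.2 = c}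

/-- The blocks with label `c`. -/
def blockClass (X : Type*) {C : ℕ} (m : ℕ) (c : Fin C) : Set (Block X C m) := {b | b.1.2 = c}

/-- The image of a block at position `o`, with the label of the block. -/
def Block.labelled (o : Option (Fin m)) (b : Block X C m) : X × Fin C := (b.image o, b.1.2)

theorem measurableSet_classSet (c : Fin C) : MeasurableSet (classSet X c) :=
  measurable_snd (measurableSet_singleton c)

theorem measurableSet_blockClass (c : Fin C) : MeasurableSet (blockClass X m c) :=
  (measurable_snd.comp measurable_fst) (measurableSet_singleton c)

theorem measurable_image (o : Option (Fin m)) : Measurable fun b : Block X C m => b.image o := by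
  cases o with
  | none => exact measurable_fst.comp measurable_fst
  | some k => exact (measurable_pi_apply k).comp measurable_snd

theorem measurePreserving_cond {Ω Ω' : Type*} [MeasurableSpace Ω] [MeasurableSpace Ω']
    {μ : Measure Ω} {ν : Measure Ω'} {e : Ω → Ω'} (he : MeasurePreserving e μ ν) {s : Set Ω'}
    (hs : MeasurableSet s) : MeasurePreserving e (μ[|e ⁻¹' s]) (ν[|s]) := by
  unfold ProbabilityTheory.cond
  rw [he.measure_preimage hs.nullMeasurableSet]
  exact (he.restrict_preimage hs).smul_measure _

theorem measurePreserving_labelled_cond {μ : Measure (Block X C m)} {D : Measure (X × Fin C)}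
    {o : Option (Fin m)} (h : MeasurePreserving (Block.labelled o) μ D) (c : Fin C) :
    MeasurePreserving (Block.labelled o) (μ[|blockClass X m c]) (D[|classSet X c]) :=
  measurePreserving_cond h (measurableSet_classSet c)

theorem measure_blockClass {μ : Measure (Block X C m)} {D : Measure (X × Fin C)}
    {o : Option (Fin m)} (h : MeasurePreserving (Block.labelled o) μ D) (c : Fin C) :
    μ (blockClass X m c) = D (classSet X c) :=
  h.measure_preimage (measurableSet_classSet c).nullMeasurableSet

/-- The expected loss of a model on class `y`. -/
def classError (D : Measure (X × Fin C)) (ℓ : ι → X → Fin C → ℝ) (t : ι) (y : Fin C) : ℝ :=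
  ∫ z, ℓ t z.1 y ∂D[|classSet X y]

/-- The largest weighted deviation, over the model class, of the losses of the items from the
expected losses of their classes. -/
def deviation (D : Measure (X × Fin C)) (ℓ : ι → X → Fin C → ℝ) (v : Item n m → ℝ)
    (y : Fin n → Fin C) (w : Fin n → Block X C m) : ℝ :=
  ⨆ t, ∑ it, v it * (classError D ℓ t (y it.1) - ℓ t ((w it.1).image it.2) (y it.1))

theorem abs_ciSup_sub_ciSup_le [Nonempty ι] {g h : ι → ℝ} (hg : Bdd g) (hh : Bdd h) {r : ℝ}
    (H : ∀ t, |g t - h t| ≤ r) : |(⨆ t, g t) - ⨆ t, h t| ≤ r := by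
  refine abs_sub_le_iff.2 ⟨?_, ?_⟩ <;> rw [sub_le_iff_le_add] <;> refine ciSup_le fun t => ?_
  · linarith [hh.le_ciSup t, (abs_sub_le_iff.1 (H t)).1]
  · linarith [hg.le_ciSup t, (abs_sub_le_iff.1 (H t)).2]

variable {ℓ φ : ι → X → Fin C → ℝ} {B M Λ W : ℝ} {D : Measure (X × Fin C)}

theorem IsLossClass.abs_loss_le (h : IsLossClass ℓ φ B M Λ) (t : ι) (x : X) (y : Fin C) :
    |ℓ t x y| ≤ B := by
  rw [abs_of_nonneg (h.loss_nonneg t x y)]; exact h.loss_le t x y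

theorem classError_nonneg (h : IsLossClass ℓ φ B M Λ) (t : ι) (y : Fin C) :
    0 ≤ classError D ℓ t y := integral_nonneg fun z => h.loss_nonneg t z.1 y

theorem measurable_deviation [Countable ι] (h : IsLossClass ℓ φ B M Λ) (v : Item n m → ℝ)
    (y : Fin n → Fin C) : Measurable (deviation (X := X) D ℓ v y) := by
  refine Measurable.iSup fun t => Finset.measurable_sum _ fun it _ => Measurable.const_mul
    (Measurable.const_sub ?_ _) _
  exact (h.measurable_loss t (y it.1)).comp ((measurable_image it.2).comp
    (measurable_pi_apply it.1))

variable [IsProbabilityMeasure D] {μ : Measure (Block X C m)} [IsProbabilityMeasure μ]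

theorem classError_le (h : IsLossClass ℓ φ B M Λ) (hB : 0 ≤ B) (t : ι) (y : Fin C) :
    classError D ℓ t y ≤ B := by
  rcases eq_or_ne (D (classSet X y)) 0 with h0 | h0
  · simpa [classError, cond_eq_zero_of_meas_eq_zero h0] using hB
  · have := cond_isProbabilityMeasure h0
    exact (le_abs_self _).trans (abs_integral_le_of_abs_le fun z => h.abs_loss_le t z.1 y)

theorem abs_classError_sub_le (h : IsLossClass ℓ φ B M Λ) (hB : 0 ≤ B) (t : ι) (x : X)
    (y : Fin C) : |classError D ℓ t y - ℓ t x y| ≤ B :=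
  abs_sub_le_iff.2 ⟨by linarith [classError_le (D := D) h hB t y, h.loss_nonneg t x y],
    by linarith [classError_nonneg (D := D) h t y, h.loss_le t x y]⟩

theorem abs_deviation_term_le (h : IsLossClass ℓ φ B M Λ) (hB : 0 ≤ B) {v : Item n m → ℝ}
    (hv : ∀ it, 0 ≤ v it) (y : Fin n → Fin C) (w : Fin n → Block X C m) (t : ι) :
    |∑ it, v it * (classError D ℓ t (y it.1) - ℓ t ((w it.1).image it.2) (y it.1))|
      ≤ ∑ it, v it * B := by
  refine (Finset.abs_sum_le_sum_abs _ _).trans (Finset.sum_le_sum fun it _ => ?_)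
  rw [abs_mul, abs_of_nonneg (hv it)]
  exact mul_le_mul_of_nonneg_left (abs_classError_sub_le h hB _ _ _) (hv it)

/-- The part of the deviation that comes from one position `o` in the blocks and one class `c`. -/
theorem integral_position_class_deviation_le [Countable ι] [Nonempty ι]
    (h : IsLossClass ℓ φ B M Λ) (hB : 0 ≤ B) (hΛ : 0 ≤ Λ) (hW : 0 ≤ W) {v : Item n m → ℝ}
    (hv : ∀ it, 0 ≤ v it) (hvW : ∀ it, v it ≤ W) {y : Fin n → Fin C}
    (hy : ∀ i, D (classSet X (y i)) ≠ 0) {o : Option (Fin m)}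
    (hμ : MeasurePreserving (Block.labelled o) μ D) (c : Fin C) :
    ∫ w : Fin n → Block X C m, ⨆ t, ∑ i, (if y i = c then
        v (i, o) * (classError D ℓ t (y i) - ℓ t ((w i).image o) (y i)) else 0)
        ∂Measure.pi (fun i => μ[|blockClass X m (y i)])
      ≤ 2 * (Λ * W) * partRad (fun t z => φ t z.1) (D[|classSet X c])
          (Finset.univ.filter fun i => y i = c) := by
  set A := Finset.univ.filter fun i => y i = c with hA
  have hD : ∀ i, IsProbabilityMeasure (D[|classSet X (y i)]) :=
    fun i => cond_isProbabilityMeasure (hy i)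
  have hμ' : ∀ i, IsProbabilityMeasure (μ[|blockClass X m (y i)]) :=
    fun i => cond_isProbabilityMeasure (by rw [measure_blockClass hμ]; exact hy i)
  let F : ι → Fin n → X × Fin C → ℝ := fun t i z => if y i = c then v (i, o) * ℓ t z.1 (y i) else 0
  have hF : ∀ t i, Measurable (F t i) := fun t i => by
    by_cases hi : y i = c
    · simp only [F, hi, if_true]
      exact ((h.measurable_loss t c).comp measurable_fst).const_mul _
    · simp only [F, hi, if_false]; exact measurable_const
  have hFM : ∀ t i z, |F t i z| ≤ v (i, o) * B := fun t i z => by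
    have h0 := hv (i, o)
    by_cases hi : y i = c
    · simp only [F, hi, if_true]
      rw [abs_mul, abs_of_nonneg h0]
      exact mul_le_mul_of_nonneg_left (h.abs_loss_le _ _ _) h0
    · simp only [F, hi, if_false, abs_zero]; positivity
  have hFe : ∀ t i, ∫ z, F t i z ∂D[|classSet X (y i)]
      = if y i = c then v (i, o) * classError D ℓ t (y i) else 0 := fun t i => by
    by_cases hi : y i = c
    · simp only [F, hi, if_true, integral_const_mul, classError]
    · simp [F, hi]
  have hmp : MeasurePreserving (fun (w : Fin n → Block X C m) i => Block.labelled o (w i))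
      (Measure.pi fun i => μ[|blockClass X m (y i)])
      (Measure.pi fun i => D[|classSet X (y i)]) :=
    measurePreserving_pi _ _ fun i => measurePreserving_labelled_cond hμ (y i)
  have hGm : Measurable fun z : Fin n → X × Fin C =>
      ⨆ t, ∑ i, ((∫ x, F t i x ∂D[|classSet X (y i)]) - F t i (z i)) :=
    Measurable.iSup fun t => Finset.measurable_sum _ fun i _ =>
      ((hF t i).comp (measurable_pi_apply i)).const_sub _
  have e1 : ∀ (w : Fin n → Block X C m) t, (∑ i, (if y i = c then
        v (i, o) * (classError D ℓ t (y i) - ℓ t ((w i).image o) (y i)) else 0))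
      = ∑ i, ((∫ x, F t i x ∂D[|classSet X (y i)]) - F t i (Block.labelled o (w i))) := by
    intro w t
    refine Finset.sum_congr rfl fun i _ => ?_
    rw [hFe]
    by_cases hi : y i = c <;> simp [F, hi, Block.labelled, mul_sub]
  simp only [e1]
  rw [integral_comp_of_measurePreserving hmp hGm, mul_assoc]
  refine (integral_sup_deviation_le _ hF hFM).trans (mul_le_mul_of_nonneg_left ?_ two_pos.le)
  have hφ' : ∀ t j, Measurable fun z : X × Fin C => φ t z.1 j := fun t j =>
    (h.measurable_model t j).comp measurable_fst
  have hM' : ∀ t (z : X × Fin C) j, |φ t z.1 j| ≤ M := fun t z j => h.abs_model_le t z.1 j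
  have hcontr : ∀ z : Fin n → X × Fin C, 𝔼 σ : Fin n → Bool, ⨆ t, ∑ i, sign (σ i) * F t i (z i)
      ≤ Λ * W * rad (restrictTo (fun t z => φ t z.1) A z) := by
    intro z
    rw [← rad_const_mul (by positivity)]
    refine rad_contraction (fun i => ⟨_, fun t => hFM t i (z i)⟩)
      (fun i j => (bdd_restrictTo hM' A z i j).const_mul _) fun t t' i => ?_
    by_cases hi : y i = c
    · have e2 : (fun j => Λ * W * restrictTo (fun t (z : X × Fin C) => φ t z.1) A z t i j)
          - (fun j => Λ * W * restrictTo (fun t (z : X × Fin C) => φ t z.1) A z t' i j)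
          = (Λ * W) • (φ t (z i).1 - φ t' (z i).1) := by
        ext j
        simp [restrictTo, hA, hi, mul_sub]
      rw [e2, norm_smul, Real.norm_of_nonneg (by positivity)]
      simp only [F, hi, if_true]
      rw [← mul_sub, abs_mul, abs_of_nonneg (hv _), mul_comm Λ W, mul_assoc]
      exact mul_le_mul (hvW _) (h.lipschitz t t' _ _) (abs_nonneg _) hW
    · simp [F, hi]
  have hlhs : Integrable (fun z : Fin n → X × Fin C =>
      𝔼 σ : Fin n → Bool, ⨆ t, ∑ i, sign (σ i) * F t i (z i))
      (Measure.pi fun i => D[|classSet X (y i)]) := by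
    simp only [Finset.expect_eq_sum_div_card]
    refine Integrable.div_const (integrable_finsetSum _ fun σ _ => integrable_of_bdd
      (Measurable.iSup fun t => Finset.measurable_sum _ fun i _ =>
        ((hF t i).comp (measurable_pi_apply i)).const_mul _)
      ⟨∑ i, v (i, o) * B, fun z => abs_ciSup_le fun t => ?_⟩) _
    refine (Finset.abs_sum_le_sum_abs _ _).trans (Finset.sum_le_sum fun i _ => ?_)
    rw [abs_mul, abs_sign, one_mul]
    exact hFM _ _ _
  refine (integral_mono hlhs ((integrable_rad_restrictTo hφ' hM' A _).const_mul _) hcontr).trans ?_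
  rw [integral_const_mul]
  refine mul_le_mul_of_nonneg_left (le_of_eq ?_) (by positivity)
  rcases A.eq_empty_or_nonempty with hAe | ⟨i₀, hi₀⟩
  · simp [partRad, hAe, rad, signSum, restrictTo]
  · have hyc : y i₀ = c := by simpa [hA] using hi₀
    have hDc : IsProbabilityMeasure (D[|classSet X c]) := by rw [← hyc]; exact hD i₀
    refine integral_pi_congr _ (fun _ => D[|classSet X c]) (A := A) (fun i hi => ?_)
      (measurable_rad_restrictTo hφ' A) fun z z' hz => rad_restrictTo_congr _ hz
    rw [show y i = c by simpa [hA] using hi]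

/-- Given the labels, the expected deviation is bounded by the Rademacher averages of the
classes. -/
theorem integral_deviation_le [Countable ι] [Nonempty ι] (h : IsLossClass ℓ φ B M Λ) (hB : 0 ≤ B)
    (hΛ : 0 ≤ Λ) (hW : 0 ≤ W) {v : Item n m → ℝ} (hv : ∀ it, 0 ≤ v it) (hvW : ∀ it, v it ≤ W)
    {y : Fin n → Fin C} (hy : ∀ i, D (classSet X (y i)) ≠ 0)
    (hμ : ∀ o, MeasurePreserving (Block.labelled o) μ D) :
    ∫ w, deviation D ℓ v y w ∂Measure.pi (fun i => μ[|blockClass X m (y i)])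
      ≤ (m + 1) * (2 * (Λ * W) * ∑ c, partRad (fun t z => φ t z.1) (D[|classSet X c])
          (Finset.univ.filter fun i => y i = c)) := by
  have hμ' : ∀ i, IsProbabilityMeasure (μ[|blockClass X m (y i)]) :=
    fun i => cond_isProbabilityMeasure (by rw [measure_blockClass (hμ none)]; exact hy i)
  let T : Option (Fin m) → Fin C → ι → (Fin n → Block X C m) → ℝ := fun o c t w =>
    ∑ i, (if y i = c then
        v (i, o) * (classError D ℓ t (y i) - ℓ t ((w i).image o) (y i)) else 0)
  have hTb : ∀ o c t w, |T o c t w| ≤ ∑ i, v (i, o) * B := fun o c t w => by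
    refine (Finset.abs_sum_le_sum_abs _ _).trans (Finset.sum_le_sum fun i _ => ?_)
    have h0 := hv (i, o)
    by_cases hi : y i = c
    · rw [if_pos hi, abs_mul, abs_of_nonneg h0]
      exact mul_le_mul_of_nonneg_left (abs_classError_sub_le h hB _ _ _) h0
    · rw [if_neg hi, abs_zero]; positivity
  have hTm : ∀ o c, Measurable fun w => ⨆ t, T o c t w := fun o c => by
    refine Measurable.iSup fun t => Finset.measurable_sum _ fun i _ => ?_
    by_cases hi : y i = c
    · simp only [hi, if_true]
      exact (((h.measurable_loss t c).comp ((measurable_image o).comp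
        (measurable_pi_apply i))).const_sub _).const_mul _
    · simp only [hi, if_false]; exact measurable_const
  have hTi : ∀ o c, Integrable (fun w => ⨆ t, T o c t w)
      (Measure.pi (fun i => μ[|blockClass X m (y i)])) := fun o c =>
    integrable_of_bdd (hTm o c) ⟨_, fun w => abs_ciSup_le fun t => hTb o c t w⟩
  have hle : ∀ w, deviation D ℓ v y w ≤ ∑ o, ∑ c, ⨆ t, T o c t w := by
    intro w
    refine ciSup_le fun t => ?_
    rw [Fintype.sum_prod_type, Finset.sum_comm]
    refine Finset.sum_le_sum fun o _ => ?_
    calc _ = ∑ c, T o c t w := by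
          simp only [T]
          rw [Finset.sum_comm]
          exact Finset.sum_congr rfl fun i _ => by simp
      _ ≤ _ := Finset.sum_le_sum fun c _ => Bdd.le_ciSup ⟨_, fun t => hTb o c t w⟩ t
  have hdi : Integrable (deviation D ℓ v y) (Measure.pi (fun i => μ[|blockClass X m (y i)])) :=
    integrable_of_bdd (measurable_deviation h v y)
      ⟨_, fun w => abs_ciSup_le (abs_deviation_term_le h hB hv y w)⟩
  have hsi : Integrable (fun w => ∑ o, ∑ c, ⨆ t, T o c t w)
      (Measure.pi (fun i => μ[|blockClass X m (y i)])) :=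
    integrable_finsetSum _ fun o _ => integrable_finsetSum _ fun c _ => hTi o c
  refine (integral_mono hdi hsi hle).trans ?_
  rw [integral_finsetSum _ fun o _ => integrable_finsetSum _ fun c _ => hTi o c]
  calc _ ≤ ∑ _o : Option (Fin m), 2 * (Λ * W) * ∑ c, partRad (fun t z => φ t z.1)
        (D[|classSet X c]) (Finset.univ.filter fun i => y i = c) := by
        refine Finset.sum_le_sum fun o _ => ?_
        rw [integral_finsetSum _ fun c _ => hTi o c, Finset.mul_sum]
        exact Finset.sum_le_sum fun c _ =>
          integral_position_class_deviation_le h hB hΛ hW hv hvW hy (hμ o) c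
    _ = _ := by simp

/-- Given the labels, the deviation is concentrated around its mean. The variance proxy is the
sum of the squared total weights of the blocks, hence at most their maximum when the weights sum
to `1`. -/
theorem measureReal_deviation_ge_le [Countable ι] [Nonempty ι] (h : IsLossClass ℓ φ B M Λ)
    (hB : 0 < B) {v : Item n m → ℝ} (hv : ∀ it, 0 ≤ v it) (hv1 : ∑ it, v it ≤ 1)
    (hW : 0 < W) (hvW : ∀ i, ∑ o, v (i, o) ≤ W) {y : Fin n → Fin C}
    (hy : ∀ i, μ (blockClass X m (y i)) ≠ 0) {E u : ℝ}
    (hE : ∫ w, deviation D ℓ v y w ∂Measure.pi (fun i => μ[|blockClass X m (y i)]) ≤ E)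
    (hu : 0 ≤ u) :
    (Measure.pi fun i => μ[|blockClass X m (y i)]).real
      {w | E + Real.sqrt (B ^ 2 * W * u / 2) ≤ deviation D ℓ v y w} ≤ Real.exp (-u) := by
  have hμ' : ∀ i, IsProbabilityMeasure (μ[|blockClass X m (y i)]) :=
    fun i => cond_isProbabilityMeasure (hy i)
  have hs : ∀ i, 0 ≤ ∑ o, v (i, o) := fun i => Finset.sum_nonneg fun o _ => hv _
  have hmc := measureReal_ge_le_of_bounded_differences
    (fun i => μ[|blockClass X m (y i)]) (measurable_deviation (D := D) h v y)
    ⟨_, fun w => abs_ciSup_le (abs_deviation_term_le h hB.le hv y w)⟩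
    (c := fun i => B * ∑ o, v (i, o)) ?_ (V := B ^ 2 * W) (u := u) (by positivity) ?_ hu
  · refine le_trans (measureReal_mono fun w hw => ?_) hmc
    exact le_trans (add_le_add_left hE _) hw
  · intro i w b
    refine abs_ciSup_sub_ciSup_le ⟨_, abs_deviation_term_le h hB.le hv y _⟩
      ⟨_, abs_deviation_term_le h hB.le hv y _⟩ fun t => ?_
    rw [← Finset.sum_sub_distrib, Fintype.sum_prod_type, Finset.sum_eq_single i]
    · rw [Finset.mul_sum]
      refine (Finset.abs_sum_le_sum_abs _ _).trans (Finset.sum_le_sum fun o _ => ?_)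
      rw [← mul_sub, abs_mul, abs_of_nonneg (hv _), mul_comm]
      refine mul_le_mul_of_nonneg_right ?_ (hv _)
      refine abs_sub_le_iff.2 ⟨?_, ?_⟩
      · linarith [h.loss_nonneg t ((Function.update w i b i).image o) (y i),
          h.loss_le t ((w i).image o) (y i)]
      · linarith [h.loss_nonneg t ((w i).image o) (y i),
          h.loss_le t ((Function.update w i b i).image o) (y i)]
    · intro k _ hk
      simp [Function.update_of_ne hk]
    · simp
  · calc ∑ i, (B * ∑ o, v (i, o)) ^ 2 ≤ ∑ i, B ^ 2 * (W * ∑ o, v (i, o)) := by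
          refine Finset.sum_le_sum fun i _ => ?_
          rw [mul_pow, sq (∑ o, v (i, o))]
          have := mul_le_mul_of_nonneg_right (hvW i) (hs i)
          gcongr
      _ = B ^ 2 * (W * ∑ it, v it) := by
          rw [Fintype.sum_prod_type, Finset.mul_sum, Finset.mul_sum]
      _ ≤ B ^ 2 * (W * 1) := by gcongr
      _ = _ := by ring

end Conditional

section Weights

variable {X : Type*} {C n m : ℕ}

/-- The number of target-class items that are not poisoned. -/
def cleanTargetCount (c : Fin C) (y : Fin n → Fin C) (s : Mask n m) : ℕ :=
  (Finset.univ.filter fun it : Item n m => y it.1 = c ∧ s it = false).card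

/-- Weights that make up for the poisoned items: they get the weight `0`, and the unpoisoned items
of the target class share the weight of the whole class equally. -/
def weight (c : Fin C) (y : Fin n → Fin C) (s : Mask n m) (it : Item n m) : ℝ :=
  if s it = true then 0
  else if y it.1 = c then
    (targetCount m c y : ℝ) / cleanTargetCount c y s / Fintype.card (Item n m)
  else 1 / Fintype.card (Item n m)

theorem weight_nonneg (c : Fin C) (y : Fin n → Fin C) (s : Mask n m) (it : Item n m) :
    0 ≤ weight c y s it := by
  unfold weight
  split_ifs <;> positivity

theorem targetCount_eq (c : Fin C) (y : Fin n → Fin C) :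
    targetCount m c y = (Finset.univ.filter fun i => y i = c).card * (m + 1) := by
  have : (Finset.univ.filter fun it : Item n m => y it.1 = c)
      = (Finset.univ.filter fun i => y i = c) ×ˢ Finset.univ := by
    ext it; simp
  rw [targetCount, this, Finset.card_product]
  simp

theorem card_item : Fintype.card (Item n m) = n * (m + 1) := by simp [Item]

variable {c : Fin C} {y : Fin n → Fin C} {s : Mask n m} {α : ℝ}

theorem targetCount_eq_add (hs : ∀ it, s it = true → y it.1 = c) :
    targetCount m c y = cleanTargetCount c y s + poisonCount s := by
  rw [targetCount, cleanTargetCount, poisonCount, ← Finset.card_union_of_disjoint]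
  · congr 1
    ext it
    have := hs it
    cases h : s it <;> simp_all
  · exact Finset.disjoint_filter.2 fun it _ h => by simp [h.2]

theorem targetCount_le (hs : ∀ it, s it = true → y it.1 = c)
    (hα : (poisonCount s : ℝ) ≤ α * targetCount m c y) :
    (1 - α) * targetCount m c y ≤ cleanTargetCount c y s := by
  have : (targetCount m c y : ℝ) = cleanTargetCount c y s + poisonCount s := by
    exact_mod_cast targetCount_eq_add hs
  linarith

theorem weight_le (hα₀ : 0 ≤ α) (hα₁ : α < 1) (hs : ∀ it, s it = true → y it.1 = c)
    (hα : (poisonCount s : ℝ) ≤ α * targetCount m c y) (it : Item n m) :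
    weight c y s it ≤ (if s it = true then 0 else 1 / (1 - α) / Fintype.card (Item n m)) := by
  have h1 : 0 < 1 - α := by linarith
  unfold weight
  split_ifs with h h'
  · exact le_rfl
  · refine div_le_div_of_nonneg_right ?_ (Nat.cast_nonneg _)
    rw [div_le_div_iff₀ _ h1]
    · linarith [targetCount_le hs hα]
    · have : 0 < cleanTargetCount c y s :=
        Finset.card_pos.2 ⟨it, by simp [h', h]⟩
      exact_mod_cast this
  · refine div_le_div_of_nonneg_right ?_ (Nat.cast_nonneg _)
    rw [le_div_iff₀ h1]; linarith

/-- The weights of a class add up to its frequency in the sample. -/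
theorem sum_weight_class (hα₁ : α < 1) (hs : ∀ it, s it = true → y it.1 = c)
    (hα : (poisonCount s : ℝ) ≤ α * targetCount m c y) (c' : Fin C) :
    ∑ it, (if y it.1 = c' then weight c y s it else 0)
      = ((Finset.univ.filter fun i => y i = c').card : ℝ) / n := by
  have hfreq : (targetCount m c' y : ℝ) / Fintype.card (Item n m)
      = ((Finset.univ.filter fun i => y i = c').card : ℝ) / n := by
    rw [targetCount_eq, card_item]
    push_cast
    exact mul_div_mul_right _ _ (by positivity)
  rw [← hfreq]
  by_cases hc : c' = c
  · subst hc
    have e : ∀ it : Item n m, (if y it.1 = c' then weight c' y s it else 0)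
        = if y it.1 = c' ∧ s it = false then
          (targetCount m c' y : ℝ) / cleanTargetCount c' y s / Fintype.card (Item n m) else 0 := by
      intro it
      cases h : s it <;> by_cases h' : y it.1 = c' <;> simp [weight, h, h']
    simp only [e]
    rw [← Finset.sum_filter, Finset.sum_const, nsmul_eq_mul]
    change (cleanTargetCount c' y s : ℝ) * _ = _
    have h1 := targetCount_le hs hα
    rcases eq_or_ne (cleanTargetCount c' y s : ℝ) 0 with h0 | h0
    · -- then the class is empty
      have : (targetCount m c' y : ℝ) = 0 := by
        rw [h0] at h1
        have h2 : (0 : ℝ) ≤ targetCount m c' y := Nat.cast_nonneg _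
        nlinarith
      simp [this]
    · field_simp
  · have e : ∀ it : Item n m, (if y it.1 = c' then weight c y s it else 0)
        = if y it.1 = c' then 1 / (Fintype.card (Item n m) : ℝ) else 0 := by
      intro it
      by_cases h' : y it.1 = c'
      · have hne : y it.1 ≠ c := fun h => hc (h'.symm.trans h)
        have hsf : s it ≠ true := fun h => hne (hs it h)
        rw [if_pos h', if_pos h', weight, if_neg hsf, if_neg hne]
      · simp [h']
    simp only [e]
    rw [← Finset.sum_filter, Finset.sum_const, nsmul_eq_mul]
    change (targetCount m c' y : ℝ) * _ = _
    ring

theorem sum_weight_mul (hα₁ : α < 1) (hs : ∀ it, s it = true → y it.1 = c)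
    (hα : (poisonCount s : ℝ) ≤ α * targetCount m c y) (g : Fin C → ℝ) :
    ∑ it, weight c y s it * g (y it.1)
      = ∑ c', ((Finset.univ.filter fun i => y i = c').card : ℝ) / n * g c' := by
  simp only [← sum_weight_class hα₁ hs hα, Finset.sum_mul]
  rw [Finset.sum_comm]
  exact Finset.sum_congr rfl fun it _ => by simp [ite_mul]

theorem sum_weight (hn : 0 < n) (hα₁ : α < 1) (hs : ∀ it, s it = true → y it.1 = c)
    (hα : (poisonCount s : ℝ) ≤ α * targetCount m c y) : ∑ it, weight c y s it = 1 := by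
  have h := sum_weight_mul hα₁ hs hα fun _ => 1
  simp only [mul_one] at h
  rw [h, ← Finset.sum_div, ← Nat.cast_sum, ← Finset.card_eq_sum_card_fiberwise (by simp)]
  simp [hn.ne']

/-- The weighted losses of the unpoisoned data are controlled by the risk on the poisoned data,
since poisoning only changes the images of items of weight `0`. -/
theorem sum_weight_mul_loss_le (hα₀ : 0 ≤ α) (hα₁ : α < 1) (hs : ∀ it, s it = true → y it.1 = c)
    (hα : (poisonCount s : ℝ) ≤ α * targetCount m c y) {loss : Output C → Fin C → ℝ}
    {g : X → Output C} (hg : ∀ x y, 0 ≤ loss (g x) y) (w : Fin n → Block X C m)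
    (x' : Item n m → X) :
    ∑ it, weight c y s it * loss (g ((w it.1).image it.2)) (y it.1)
      ≤ 1 / (1 - α) * empRisk loss g (poisonedImages w s x') y := by
  have h1 : 0 < 1 - α := by linarith
  rw [empRisk, mul_div_assoc', Finset.mul_sum, Finset.sum_div]
  refine Finset.sum_le_sum fun it _ => ?_
  refine (mul_le_mul_of_nonneg_right (weight_le hα₀ hα₁ hs hα it) (hg _ _)).trans ?_
  have h0 := hg (poisonedImages w s x' it) (y it.1)
  split_ifs with h
  · rw [zero_mul]; positivity
  · have : poisonedImages w s x' it = (w it.1).image it.2 := by simp [poisonedImages, h]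
    rw [this]
    exact le_of_eq (by ring)

end Weights

/-! ### Conditioning on the labels -/

section Attack

variable {X : Type*} {C n m : ℕ}

theorem labels_preimage_singleton (y : Fin n → Fin C) :
    (labels : (Fin n → Block X C m) → Fin n → Fin C) ⁻¹' {y}
      = Set.univ.pi fun i => blockClass X m (y i) := by
  ext w
  simp [labels, blockClass, funext_iff]

theorem hits_blockClass (c : Fin C) (w : Fin n → Block X C m) :
    hits (blockClass X m c) w = Finset.univ.filter fun i => labels w i = c := by
  ext i
  simp only [hits, Finset.mem_filter, Finset.mem_univ, true_and]
  rfl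

variable [MeasurableSpace X]

theorem measurePreserving_labelled (D : Measure (X × Fin C)) [IsProbabilityMeasure D]
    (G : Kernel (X × Fin C) (Fin m → X)) [IsMarkovKernel G]
    (hG : ∀ k : Fin m, (D.compProd G).map (fun b => (b.2 k, b.1.2)) = D) (o : Option (Fin m)) :
    MeasurePreserving (Block.labelled o) (D.compProd G) D := by
  refine ⟨(measurable_image o).prodMk (measurable_snd.comp measurable_fst), ?_⟩
  cases o with
  | none => exact Measure.fst_compProd D G
  | some k => exact hG k

instance isMarkovKernel_sel (sel : (Fin n → Fin C) → PMF (Mask n m)) :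
    IsMarkovKernel (Kernel.ofFunOfCountable fun y => (sel y).toMeasure) :=
  ⟨fun y => PMF.toMeasure.isProbabilityMeasure (sel y)⟩

instance isProbabilityMeasure_attackLaw (D : Measure (X × Fin C)) [IsProbabilityMeasure D]
    (G : Kernel (X × Fin C) (Fin m → X)) [IsMarkovKernel G]
    (sel : (Fin n → Fin C) → PMF (Mask n m)) : IsProbabilityMeasure (attackLaw D G sel) := by
  unfold attackLaw
  infer_instance

/-- Conditioning on the labels. An event has small probability if the label vectors `y` in `Y`
are unlikely and if, for any other `y` and any mask `s` that can be selected for `y`, the event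
is unlikely when the blocks are drawn independently with the labels `y`. -/
theorem attackLaw_le (D : Measure (X × Fin C)) [IsProbabilityMeasure D]
    (G : Kernel (X × Fin C) (Fin m → X)) [IsMarkovKernel G]
    (sel : (Fin n → Fin C) → PMF (Mask n m)) (Y : Set (Fin n → Fin C))
    {E : Set ((Fin n → Block X C m) × Mask n m)}
    {A : (Fin n → Fin C) → Mask n m → Set (Fin n → Block X C m)}
    (hA : ∀ y s, MeasurableSet (A y s)) {ε : ℝ≥0∞}
    (hε : ∀ y ∉ Y, ∀ s ∈ (sel y).support, (∀ i, (D.compProd G) (blockClass X m (y i)) ≠ 0) →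
      (Measure.pi fun i => (D.compProd G)[|blockClass X m (y i)]) (A y s) ≤ ε)
    (hE : ∀ ω ∈ E, labels ω.1 ∉ Y → ω.2 ∈ (sel (labels ω.1)).support →
      ω.1 ∈ A (labels ω.1) ω.2) :
    attackLaw D G sel E
      ≤ (Measure.pi fun _ : Fin n => D.compProd G) (labels ⁻¹' Y) + ε := by
  classical
  set μ := D.compProd G with hμ
  set P := Measure.pi fun _ : Fin n => μ with hP
  have hlab : ∀ S : Set (Fin n → Fin C),
      MeasurableSet ((labels : (Fin n → Block X C m) → Fin n → Fin C) ⁻¹' S) := fun S =>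
    measurable_labels (Set.to_countable S).measurableSet
  have hprod : ∀ {S : Set (Fin n → Block X C m)}, MeasurableSet S → ∀ T : Set (Mask n m),
      attackLaw D G sel (S ×ˢ T) = ∫⁻ w in S, (sel (labels w)).toMeasure T ∂P := fun hS T => by
    rw [attackLaw, Measure.compProd_apply_prod hS (Set.to_countable T).measurableSet]
    rfl
  -- the part of the event with labels `y` and mask `s`
  let A' : (Fin n → Fin C) → Mask n m → Set (Fin n → Block X C m) := fun y s =>
    labels ⁻¹' {y} ∩ if y ∈ Y then ∅ else if s ∈ (sel y).support then A y s else Set.univ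
  have hA' : ∀ y s, MeasurableSet (A' y s) := fun y s => by
    refine (hlab _).inter ?_
    split_ifs
    exacts [MeasurableSet.empty, hA y s, MeasurableSet.univ]
  have hsub : E ⊆ (labels ⁻¹' Y) ×ˢ Set.univ ∪ ⋃ y, ⋃ s, A' y s ×ˢ {s} := by
    rintro ⟨w, s⟩ hw
    by_cases hy : labels w ∈ Y
    · exact Or.inl ⟨hy, trivial⟩
    · refine Or.inr (Set.mem_iUnion₂.2 ⟨labels w, s, ⟨⟨rfl, ?_⟩, rfl⟩⟩)
      rw [if_neg hy]
      split_ifs with hs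
      · exact hE _ hw hy hs
      · trivial
  have hpiece : ∀ y s, attackLaw D G sel (A' y s ×ˢ {s})
      ≤ P (labels ⁻¹' {y}) * ε * sel y s := by
    intro y s
    have h1 : attackLaw D G sel (A' y s ×ˢ {s}) = P (A' y s) * sel y s := by
      rw [hprod (hA' y s)]
      rw [setLIntegral_congr_fun (g := fun _ => sel y s) (hA' y s)]
      · rw [setLIntegral_const, mul_comm]
      · intro w hw
        have : labels w = y := hw.1
        simp only [this]
        exact PMF.toMeasure_apply_singleton _ _ (measurableSet_singleton s)
    rw [h1]
    by_cases hs : s ∈ (sel y).support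
    swap
    · rw [PMF.mem_support_iff, not_not] at hs
      simp [hs]
    gcongr
    by_cases hy : y ∈ Y
    · simp [A', hy]
    simp only [A', if_neg hy, if_pos hs]
    by_cases h0 : ∀ i, μ (blockClass X m (y i)) ≠ 0
    · rw [← cond_mul_eq_inter (hlab {y}), mul_comm, labels_preimage_singleton,
        cond_pi (fun _ => μ) (fun i => measurableSet_blockClass (y i)) h0]
      gcongr
      exact hε y hy s hs h0
    · push Not at h0
      obtain ⟨i, hi⟩ := h0
      have : P (labels ⁻¹' {y}) = 0 := by
        rw [labels_preimage_singleton, hP, Measure.pi_pi]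
        exact Finset.prod_eq_zero (Finset.mem_univ i) hi
      exact (measure_mono_null Set.inter_subset_left this).le.trans zero_le
  calc attackLaw D G sel E
      ≤ attackLaw D G sel ((labels ⁻¹' Y) ×ˢ Set.univ)
        + attackLaw D G sel (⋃ y, ⋃ s, A' y s ×ˢ {s}) :=
        (measure_mono hsub).trans (measure_union_le _ _)
    _ ≤ P (labels ⁻¹' Y) + ∑ y, ∑ s, P (labels ⁻¹' {y}) * ε * sel y s := by
        gcongr
        · rw [hprod (hlab Y)]
          simp
        · refine (measure_iUnion_fintype_le _ _).trans (Finset.sum_le_sum fun y _ => ?_)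
          exact (measure_iUnion_fintype_le _ _).trans (Finset.sum_le_sum fun s _ => hpiece y s)
    _ = P (labels ⁻¹' Y) + ε := by
        congr 1
        have h1 : ∀ y, ∑ s, sel y s = 1 := fun y => by
          rw [← tsum_fintype (L := .unconditional _)]; exact (sel y).tsum_coe
        simp only [← Finset.mul_sum, h1, mul_one]
        rw [← Finset.sum_mul, sum_measure_preimage_singleton _ fun y _ => hlab {y}]
        simp

/-- The labels are typical at level `u`: no class is much more frequent than twice its
probability, and none is much less frequent than its probability. -/
def TypicalLabels (D : Measure (X × Fin C)) (u : ℝ) (y : Fin n → Fin C) : Prop :=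
  ∀ c, ((Finset.univ.filter fun i => y i = c).card : ℝ) ≤ 2 * (n * D.real (classSet X c)) + u ∧
    n * D.real (classSet X c)
      ≤ (Finset.univ.filter fun i => y i = c).card + Real.sqrt (n * u / 2)

theorem measure_not_typicalLabels_le {D : Measure (X × Fin C)} {μ : Measure (Block X C m)}
    [IsProbabilityMeasure μ] (hμ : MeasurePreserving (Block.labelled none) μ D) (hn : 0 < n)
    {u : ℝ} (hu : 0 ≤ u) :
    (Measure.pi fun _ : Fin n => μ) (labels ⁻¹' {y | ¬ TypicalLabels D u y})
      ≤ ENNReal.ofReal (2 * C * Real.exp (-u)) := by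
  set P := Measure.pi fun _ : Fin n => μ
  have hD : ∀ c, D.real (classSet X c) = μ.real (blockClass X m c) := fun c => by
    rw [measureReal_def, measureReal_def, measure_blockClass hμ]
  let S₁ : Fin C → Set (Fin n → Block X C m) := fun c =>
    {w | 2 * (n * μ.real (blockClass X m c)) + u ≤ (hits (blockClass X m c) w).card}
  let S₂ : Fin C → Set (Fin n → Block X C m) := fun c =>
    {w | (hits (blockClass X m c) w).card + Real.sqrt (n * u / 2) ≤ n * μ.real (blockClass X m c)}
  have hsub : (labels : (Fin n → Block X C m) → _) ⁻¹' {y | ¬ TypicalLabels D u y}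
      ⊆ ⋃ c, (S₁ c ∪ S₂ c) := by
    intro w hw
    have hw' : ¬ TypicalLabels D u (labels w) := hw
    unfold TypicalLabels at hw'
    push Not at hw'
    obtain ⟨c, hc⟩ := hw'
    refine Set.mem_iUnion.2 ⟨c, ?_⟩
    simp only [← hits_blockClass, hD] at hc
    by_cases h1 : ((hits (blockClass X m c) w).card : ℝ) ≤ 2 * (n * μ.real (blockClass X m c)) + u
    · exact Or.inr (hc h1).le
    · exact Or.inl (not_le.1 h1).le
  have hreal : P.real (⋃ c, (S₁ c ∪ S₂ c)) ≤ 2 * C * Real.exp (-u) := by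
    calc _ ≤ ∑ c, P.real (S₁ c ∪ S₂ c) := measureReal_iUnion_fintype_le _
      _ ≤ ∑ _c : Fin C, (Real.exp (-u) + Real.exp (-u)) := by
          refine Finset.sum_le_sum fun c _ => (measureReal_union_le _ _).trans (add_le_add ?_ ?_)
          · exact measureReal_card_hits_ge_le μ (measurableSet_blockClass c) u
          · exact measureReal_card_hits_le_le μ (measurableSet_blockClass c) hn hu
      _ = _ := by simp; ring
  refine (measure_mono hsub).trans ?_
  rw [← ofReal_measureReal]
  exact ENNReal.ofReal_le_ofReal hreal

/-- The risk is the average of the class errors. -/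
theorem integral_loss_eq {ι : Type*} {D : Measure (X × Fin C)} [IsProbabilityMeasure D]
    {ℓ φ : ι → X → Fin C → ℝ} {B M Λ : ℝ} (h : IsLossClass ℓ φ B M Λ) (t : ι) :
    ∫ z, ℓ t z.1 z.2 ∂D = ∑ c, D.real (classSet X c) * classError D ℓ t c := by
  have hm : Measurable fun z : X × Fin C => ℓ t z.1 z.2 :=
    measurable_from_prod_countable_left fun c => h.measurable_loss t c
  have hint : Integrable (fun z : X × Fin C => ℓ t z.1 z.2) D :=
    integrable_of_bdd hm ⟨B, fun z => h.abs_loss_le _ _ _⟩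
  have hU : ⋃ c, classSet X c = (Set.univ : Set (X × Fin C)) :=
    Set.eq_univ_of_forall fun z => Set.mem_iUnion.2 ⟨z.2, rfl⟩
  rw [← setIntegral_univ, ← hU, integral_iUnion_fintype measurableSet_classSet _
    fun c => hint.integrableOn]
  · refine Finset.sum_congr rfl fun c _ => ?_
    have e : ∫ z in classSet X c, ℓ t z.1 z.2 ∂D = ∫ z in classSet X c, ℓ t z.1 c ∂D :=
      setIntegral_congr_fun (measurableSet_classSet c) fun z hz => by
        simp only [show z.2 = c from hz]
    rw [e]
    rcases eq_or_ne (D (classSet X c)) 0 with h0 | h0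
    · rw [setIntegral_measure_zero _ h0, measureReal_def, h0]; simp
    · rw [classError, ProbabilityTheory.cond, integral_smul_measure, smul_eq_mul, ← mul_assoc,
        ENNReal.toReal_inv, measureReal_def,
        mul_inv_cancel₀ (ENNReal.toReal_ne_zero.2 ⟨h0, measure_ne_top _ _⟩), one_mul]
  · intro c c' hne
    exact Set.disjoint_left.2 fun z h1 h2 => hne (Eq.trans (Eq.symm h1) h2)

/-- The Rademacher complexity is determined by a dense set of parameters. -/
theorem mul_rademacher_eq {Θ : Type*} [TopologicalSpace Θ] {f : Θ → X → Output C}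
    (hfc : ∀ x, Continuous fun θ => f θ x) {S : Set Θ} (hS : Dense S) (hn : 0 < n)
    (D : Measure (X × Fin C)) :
    n * rademacher n D f
      = partRad (fun (t : S) (z : X × Fin C) j => f t z.1 j) D (Finset.univ : Finset (Fin n)) := by
  have hn' : (n : ℝ) ≠ 0 := by exact_mod_cast hn.ne'
  unfold rademacher partRad
  rw [← integral_const_mul]
  congr 1; ext z
  rw [rad, Finset.expect_eq_sum_div_card, mul_div_assoc', Finset.mul_sum, Finset.card_univ]
  congr 1
  refine Finset.sum_congr rfl fun σ _ => ?_
  have hc : Continuous fun θ => ∑ i, ∑ j, sign (σ i j) * f θ (z i).1 j :=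
    continuous_finsetSum _ fun i _ => continuous_finsetSum _ fun j _ =>
      continuous_const.mul ((EuclideanSpace.proj (𝕜 := ℝ) j).continuous.comp (hfc (z i).1))
  rw [← Real.mul_iSup_of_nonneg (by positivity), ← mul_assoc, mul_one_div_cancel hn', one_mul,
    ← hS.ciSup' hc]
  simp [signSum, restrictTo]

end Attack

/-! ### The risk bound -/

section Risk

variable {X : Type*} [MeasurableSpace X] {C n m : ℕ}

/-- The constant in front of the complexity terms, for losses bounded by `B` and outputs with
coordinates bounded by `M`. -/
def riskConst (C : ℕ) (B M : ℝ) : ℝ :=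
  B + C * B * (1 + 2 * Real.log (2 * C)) + 40 * C ^ 2
    + 4 * C ^ 3 * M * (3 * (1 + 2 * Real.log (2 * C)) + 4)

theorem log_two_mul_nonneg (hC : 0 < C) : 0 ≤ Real.log (2 * C) := by
  have : (1 : ℝ) ≤ C := by exact_mod_cast hC
  exact Real.log_nonneg (by linarith)

theorem le_riskConst (hC : 0 < C) {B M : ℝ} (hB : 0 ≤ B) (hM : 0 ≤ M) : B ≤ riskConst C B M := by
  have hl := log_two_mul_nonneg hC
  unfold riskConst
  have h1 : 0 ≤ C * B * (1 + 2 * Real.log (2 * C)) := by positivity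
  have h2 : 0 ≤ 4 * C ^ 3 * M * (3 * (1 + 2 * Real.log (2 * C)) + 4) := by positivity
  have h3 : 0 ≤ 40 * (C : ℝ) ^ 2 := by positivity
  linarith

/-- The bound on the expected deviation, given labels that are typical at the level `u`. The square
root is the bound on the Rademacher complexity. -/
def deviationBound (C n : ℕ) (α T u M : ℝ) : ℝ :=
  4 * C / (n * (1 - α)) * (C * (10 * (n * Real.sqrt (T / n)) + (3 * u + 2) * (C * M)))

/-- The errors of the class frequencies, of the mean deviation and of its fluctuation add up to the
complexity terms. The level of the typical labels is `ln (4 C / δ)`, so that each of the `2 C`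
frequency bounds fails with probability at most `δ / (4 C)`. -/
theorem complexity_terms_le (hC : 0 < C) (hn : 0 < n) {α T δ B M : ℝ} (hα₀ : 0 ≤ α) (hα₁ : α < 1)
    (hB : 0 ≤ B) (hM : 0 ≤ M) (hδ : 0 < δ) (hδ1 : δ < 1)
    (hr : Real.log (2 / δ) / (n * (1 - α)) ≤ 1) :
    C * (B * (Real.sqrt (n * Real.log (4 * C / δ) / 2) / n))
      + (deviationBound C n α T (Real.log (4 * C / δ)) M
        + Real.sqrt (B ^ 2 * (1 / (n * (1 - α))) * Real.log (2 / δ) / 2))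
    ≤ riskConst C B M * (Real.sqrt (T / (n * (1 - α) ^ 2))
        + Real.sqrt (Real.log (2 / δ) / (n * (1 - α)))) := by
  have hl := log_two_mul_nonneg hC
  have h1 : 0 < 1 - α := by linarith
  have hn' : (0 : ℝ) < n := by exact_mod_cast hn
  have hC' : (0 : ℝ) < C := by exact_mod_cast hC
  set lam := Real.log (2 / δ) with hlam
  set q := 1 + 2 * Real.log (2 * C) with hq
  have hlam2 : 1 / 2 ≤ lam := by
    have h2 : Real.log 2 ≤ lam := Real.log_le_log two_pos (by rw [le_div_iff₀ hδ]; linarith)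
    linarith [Real.log_two_gt_d9]
  have hu : Real.log (4 * C / δ) ≤ q * lam := by
    have e : 4 * (C : ℝ) / δ = (2 * C) * (2 / δ) := by ring
    rw [e, Real.log_mul (by positivity) (by positivity)]
    nlinarith
  set r := lam / (n * (1 - α)) with hrdef
  have hr0 : 0 ≤ r := by positivity
  have hrs : r ≤ Real.sqrt r := by
    have hs : Real.sqrt r ≤ 1 := Real.sqrt_le_one.2 hr
    nlinarith [Real.sq_sqrt hr0, Real.sqrt_nonneg r]
  set R := Real.sqrt (T / (n * (1 - α) ^ 2)) with hR
  have hR0 : 0 ≤ R := Real.sqrt_nonneg _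
  have hsr0 : 0 ≤ Real.sqrt r := Real.sqrt_nonneg r
  have hq1 : 1 ≤ q := by linarith
  have ht1 : Real.sqrt (n * Real.log (4 * C / δ) / 2) / n ≤ q * Real.sqrt r := by
    rw [div_le_iff₀ hn']
    refine Real.sqrt_le_iff.2 ⟨by positivity, ?_⟩
    have e : (q * Real.sqrt r * n) ^ 2 = q ^ 2 * n ^ 2 * r := by
      rw [mul_pow, mul_pow, Real.sq_sqrt hr0]; ring
    have e2 : lam ≤ n * r := by
      rw [hrdef, mul_div_assoc', le_div_iff₀ (by positivity)]
      have : lam * (n * (1 - α)) ≤ lam * (n * 1) := by gcongr; linarith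
      linarith
    rw [e]
    calc n * Real.log (4 * C / δ) / 2 ≤ n * (q * lam) / 2 := by gcongr
      _ ≤ n * (q ^ 2 * lam) := by
        have : q * lam ≤ q ^ 2 * lam := by gcongr; nlinarith
        have h3 : 0 ≤ n * (q * lam) := by positivity
        nlinarith
      _ ≤ n * (q ^ 2 * (n * r)) := by gcongr
      _ = _ := by ring
  have ht3 : Real.sqrt (B ^ 2 * (1 / (n * (1 - α))) * lam / 2) ≤ B * Real.sqrt r := by
    refine Real.sqrt_le_iff.2 ⟨by positivity, ?_⟩
    rw [mul_pow, Real.sq_sqrt hr0, hrdef]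
    have : 0 ≤ B ^ 2 * (lam / (n * (1 - α))) := by positivity
    have e : B ^ 2 * (1 / (n * (1 - α))) * lam = B ^ 2 * (lam / (n * (1 - α))) := by ring
    rw [e]; linarith
  have ht2 : deviationBound C n α T (Real.log (4 * C / δ)) M
      ≤ 40 * C ^ 2 * R + 4 * C ^ 3 * M * (3 * q + 4) * Real.sqrt r := by
    have hRT : Real.sqrt (T / n) / (1 - α) = R := by
      rw [hR, ← div_div, Real.sqrt_div' _ (sq_nonneg _), Real.sqrt_sq h1.le]
    have e : deviationBound C n α T (Real.log (4 * C / δ)) M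
        = 40 * C ^ 2 * (Real.sqrt (T / n) / (1 - α))
          + 4 * C ^ 3 * M * ((3 * Real.log (4 * C / δ) + 2) / (n * (1 - α))) := by
      unfold deviationBound
      field_simp
      ring
    rw [e, hRT]
    have h5 : (3 * Real.log (4 * C / δ) + 2) / (n * (1 - α)) ≤ (3 * q + 4) * Real.sqrt r := by
      calc _ ≤ ((3 * q + 4) * lam) / (n * (1 - α)) := by gcongr; linarith
        _ = (3 * q + 4) * r := by rw [hrdef]; ring
        _ ≤ _ := by gcongr
    have h6 : 4 * C ^ 3 * M * ((3 * Real.log (4 * C / δ) + 2) / (n * (1 - α)))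
        ≤ 4 * C ^ 3 * M * ((3 * q + 4) * Real.sqrt r) := by gcongr
    linarith
  have hK : riskConst C B M = B + C * B * q + 40 * C ^ 2 + 4 * C ^ 3 * M * (3 * q + 4) := rfl
  have h7 : C * (B * (Real.sqrt (n * Real.log (4 * C / δ) / 2) / n))
      ≤ C * (B * (q * Real.sqrt r)) := by gcongr
  have hx1 : 0 ≤ (B + C * B * q + 4 * C ^ 3 * M * (3 * q + 4)) * R := by positivity
  have hx2 : 0 ≤ 40 * (C : ℝ) ^ 2 * Real.sqrt r := by positivity
  rw [hK]
  nlinarith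

theorem norm_le_card_mul_norm (p : Output C) : ‖p‖ ≤ C * ‖(fun j => p j : Fin C → ℝ)‖ := by
  rw [EuclideanSpace.norm_eq]
  refine Real.sqrt_le_iff.2 ⟨by positivity, ?_⟩
  have h : ∀ j, ‖p j‖ ≤ ‖(fun j => p j : Fin C → ℝ)‖ := fun j =>
    norm_le_pi_norm (fun j => p j : Fin C → ℝ) j
  calc ∑ j, ‖p j‖ ^ 2 ≤ ∑ _j : Fin C, ‖(fun j => p j : Fin C → ℝ)‖ ^ 2 := by
        gcongr with j; exact h j
    _ = C * ‖(fun j => p j : Fin C → ℝ)‖ ^ 2 := by simp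
    _ ≤ _ := by
        rw [mul_pow]
        gcongr
        have : C ≤ C ^ 2 := Nat.le_self_pow two_ne_zero C
        exact_mod_cast this

/-- Given typical labels, the risk of a model exceeds the weighted empirical risk on the
unpoisoned items by at most the deviation and the error of the class frequencies. -/
theorem risk_le_of_typicalLabels {ι : Type*} {D : Measure (X × Fin C)} [IsProbabilityMeasure D]
    {ℓ φ : ι → X → Fin C → ℝ} {B M Λ : ℝ} (h : IsLossClass ℓ φ B M Λ) (hB : 0 ≤ B) (hn : 0 < n)
    {u : ℝ} {w : Fin n → Block X C m} (hy : TypicalLabels D u (labels w)) {c : Fin C} {α : ℝ}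
    {s : Mask n m} (hα₁ : α < 1) (hs : ∀ it, s it = true → labels w it.1 = c)
    (hα : (poisonCount s : ℝ) ≤ α * targetCount m c (labels w)) (t : ι) :
    ∫ z, ℓ t z.1 z.2 ∂D ≤ C * (B * (Real.sqrt (n * u / 2) / n))
      + deviation D ℓ (weight c (labels w) s) (labels w) w
      + ∑ it, weight c (labels w) s it * ℓ t ((w it.1).image it.2) (labels w it.1) := by
  have hn' : (0 : ℝ) < n := by exact_mod_cast hn
  rw [integral_loss_eq h]
  have h1 := Bdd.le_ciSup ⟨_, abs_deviation_term_le (D := D) h hB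
    (weight_nonneg c (labels w) s) (labels w) w⟩ t
  simp only [mul_sub, Finset.sum_sub_distrib] at h1
  rw [sum_weight_mul hα₁ hs hα] at h1
  have h2 : ∑ c', D.real (classSet X c') * classError D ℓ t c'
      ≤ C * (B * (Real.sqrt (n * u / 2) / n))
        + ∑ c', ((Finset.univ.filter fun i => labels w i = c').card : ℝ) / n
          * classError D ℓ t c' := by
    have e : (C : ℝ) * (B * (Real.sqrt (n * u / 2) / n))
        = ∑ _c : Fin C, B * (Real.sqrt (n * u / 2) / n) := by simp
    rw [e, ← Finset.sum_add_distrib]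
    refine Finset.sum_le_sum fun c' _ => ?_
    have h3 := (hy c').2
    have h4 : D.real (classSet X c')
        ≤ ((Finset.univ.filter fun i => labels w i = c').card : ℝ) / n
          + Real.sqrt (n * u / 2) / n := by
      rw [← add_div, le_div_iff₀ hn']; linarith
    have h5 := classError_nonneg (D := D) h t c'
    have h6 := classError_le (D := D) h hB t c'
    have h7 : 0 ≤ Real.sqrt (n * u / 2) / n := by positivity
    nlinarith [mul_le_mul_of_nonneg_right h4 h5, mul_le_mul_of_nonneg_left h6 h7]
  have h8 : deviation D ℓ (weight c (labels w) s) (labels w) w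
    = ⨆ t, ∑ it, weight c (labels w) s it
      * (classError D ℓ t (labels w it.1) - ℓ t ((w it.1).image it.2) (labels w it.1)) := rfl
  simp only [mul_sub, Finset.sum_sub_distrib] at h8
  rw [h8]
  linarith

/-- Uniformly over the class, the risk is at most `1 / (1 - α)` times the empirical risk on the
poisoned data, up to the complexity terms. -/
theorem attackLaw_risk_le {loss : Output C → Fin C → ℝ} {B M : ℝ} (hB : 0 < B) (hM : 0 ≤ M)
    (hlip : ∀ y, LipschitzWith 2 fun p => loss p y)
    (D : Measure (X × Fin C)) [IsProbabilityMeasure D]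
    (G : Kernel (X × Fin C) (Fin m → X)) [IsMarkovKernel G]
    (hG : ∀ k : Fin m, (D.compProd G).map (fun b => (b.2 k, b.1.2)) = D)
    {Θ : Type*} [TopologicalSpace Θ] [SecondCountableTopology Θ] {f : Θ → X → Output C}
    (hf : ∀ θ, Measurable (f θ)) (hfc : ∀ x, Continuous fun θ => f θ x)
    (hloss₀ : ∀ θ x y, 0 ≤ loss (f θ x) y) (hlossB : ∀ θ x y, loss (f θ x) y ≤ B)
    (hfM : ∀ θ x j, |f θ x j| ≤ M) (hn : 0 < n) {c : Fin C} {α : ℝ} (hα₀ : 0 ≤ α) (hα₁ : α < 1)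
    {sel : (Fin n → Fin C) → PMF (Mask n m)} (hsel : IsSelection c α sel) {T : ℝ}
    (hT : rademacher n D f ≤ Real.sqrt (T / n)) {δ : ℝ} (hδ : 0 < δ) :
    attackLaw D G sel {ω | ¬ ∀ (x' : Item n m → X) (θ : Θ),
        cleanError loss D (f θ) ≤ 1 / (1 - α)
            * empRisk loss (f θ) (poisonedImages ω.1 ω.2 x') (labels ω.1)
          + riskConst C B M * (Real.sqrt (T / (n * (1 - α) ^ 2))
            + Real.sqrt (Real.log (2 / δ) / (n * (1 - α))))} ≤ ENNReal.ofReal δ := by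
  have hC : 0 < C := c.pos
  have h1 : 0 < 1 - α := by linarith
  have hn' : (0 : ℝ) < n := by exact_mod_cast hn
  have hC' : (0 : ℝ) < C := by exact_mod_cast hC
  rcases le_or_gt 1 δ with hδ1 | hδ1
  · -- the probability bound is trivial
    exact prob_le_one.trans (by simpa using hδ1)
  have hlossm : ∀ θ y, Measurable fun x => loss (f θ x) y := fun θ y =>
    (hlip y).continuous.measurable.comp (hf θ)
  have hcont : ∀ x y, Continuous fun θ => loss (f θ x) y := fun x y =>
    (hlip y).continuous.comp (hfc x)
  have hEle : ∀ θ, cleanError loss D (f θ) ≤ B := fun θ =>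
    (le_abs_self _).trans (abs_integral_le_of_abs_le fun z => by
      rw [abs_of_nonneg (hloss₀ _ _ _)]; exact hlossB _ _ _)
  have hK := le_riskConst hC hB.le hM
  have hK0 : 0 ≤ riskConst C B M := hB.le.trans hK
  have hemp : ∀ (θ : Θ) (x : Item n m → X) y, 0 ≤ 1 / (1 - α) * empRisk loss (f θ) x y :=
    fun θ x y => mul_nonneg (by positivity)
      (div_nonneg (Finset.sum_nonneg fun it _ => hloss₀ _ _ _) (Nat.cast_nonneg _))
  set lam := Real.log (2 / δ) with hlam
  have hlam0 : 0 ≤ lam := Real.log_nonneg (by rw [le_div_iff₀ hδ]; linarith)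
  rcases lt_or_ge 1 (lam / (n * (1 - α))) with hr | hr
  · -- the bound exceeds the largest possible loss
    refine le_trans (le_of_eq ?_) zero_le
    convert measure_empty (μ := attackLaw D G sel)
    refine Set.eq_empty_of_forall_notMem fun ω hω => hω fun x' θ => ?_
    have h2 : 1 ≤ Real.sqrt (lam / (n * (1 - α))) := Real.one_le_sqrt.2 hr.le
    have h3 := Real.sqrt_nonneg (T / (n * (1 - α) ^ 2))
    have h4 := hemp θ (poisonedImages ω.1 ω.2 x') (labels ω.1)
    have h5 : riskConst C B M * 1 ≤ riskConst C B M * (Real.sqrt (T / (n * (1 - α) ^ 2))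
            + Real.sqrt (lam / (n * (1 - α)))) := by gcongr; linarith
    linarith [hEle θ]
  rcases isEmpty_or_nonempty Θ with hΘ | hΘ
  · refine le_trans (le_of_eq ?_) zero_le
    convert measure_empty (μ := attackLaw D G sel)
    exact Set.eq_empty_of_forall_notMem fun ω hω => hω fun x' θ => hΘ.elim θ
  -- a countable dense set of parameters
  obtain ⟨S, hSc, hSd⟩ := TopologicalSpace.exists_countable_dense Θ
  have : Countable S := hSc
  have : Nonempty S := hSd.nonempty.to_subtype
  set μ := D.compProd G with hμdef
  have hμ : ∀ o, MeasurePreserving (Block.labelled o) μ D := measurePreserving_labelled D G hG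
  let ℓ : S → X → Fin C → ℝ := fun t x y => loss (f t x) y
  let φ : S → X → Fin C → ℝ := fun t x j => f t x j
  have hcls : IsLossClass ℓ φ B M (2 * C) :=
    { measurable_loss := fun t y => hlossm t y
      measurable_model := fun t j =>
        (EuclideanSpace.proj (𝕜 := ℝ) j).continuous.measurable.comp (hf t)
      loss_nonneg := fun t x y => hloss₀ t x y
      loss_le := fun t x y => hlossB t x y
      abs_model_le := fun t x j => hfM t x j
      lipschitz := fun t t' x y => by
        have h2 := (hlip y).dist_le_mul (f t x) (f t' x)
        rw [Real.dist_eq, dist_eq_norm] at h2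
        have h3 := norm_le_card_mul_norm (f t x - f t' x)
        have e : (fun j => (f t x - f t' x) j : Fin C → ℝ) = φ t x - φ t' x := by
          ext j; simp [φ]
        rw [e] at h3
        calc |ℓ t x y - ℓ t' x y| ≤ 2 * ‖f t x - f t' x‖ := by simpa using h2
          _ ≤ 2 * (C * ‖φ t x - φ t' x‖) := by gcongr
          _ = _ := by ring }
  set u := Real.log (4 * C / δ) with hudef
  have hC1 : (1 : ℝ) ≤ C := by exact_mod_cast hC
  have hu : 0 ≤ u := Real.log_nonneg (by rw [le_div_iff₀ hδ]; linarith)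
  set E := deviationBound C n α T u M with hEdef
  set W₀ : ℝ := 1 / (1 - α) / Fintype.card (Item n m) with hW₀
  set W : ℝ := 1 / (n * (1 - α)) with hW
  have hWW : (m + 1) * W₀ = W := by
    rw [hW₀, card_item, hW]
    have hm : (m + 1 : ℝ) ≠ 0 := by positivity
    push_cast
    field_simp
  have hW₀0 : 0 ≤ W₀ := by positivity
  have hW0 : 0 < W := by positivity
  let A : (Fin n → Fin C) → Mask n m → Set (Fin n → Block X C m) := fun y s =>
    {w | E + Real.sqrt (B ^ 2 * W * lam / 2) ≤ deviation D ℓ (weight c y s) y w}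
  have hA : ∀ y s, MeasurableSet (A y s) := fun y s =>
    measurableSet_le measurable_const (measurable_deviation hcls _ _)
  have hexp : Real.exp (-lam) = δ / 2 := by
    rw [hlam, Real.exp_neg, Real.exp_log (by positivity), inv_div]
  have hexpu : 2 * C * Real.exp (-u) = δ / 2 := by
    rw [hudef, Real.exp_neg, Real.exp_log (by positivity), inv_div]
    field_simp
    ring
  have key := attackLaw_le D G sel {y | ¬ TypicalLabels D u y} hA (ε := ENNReal.ofReal (δ / 2))
    (E := {ω | ¬ ∀ (x' : Item n m → X) (θ : Θ),
        cleanError loss D (f θ) ≤ 1 / (1 - α)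
            * empRisk loss (f θ) (poisonedImages ω.1 ω.2 x') (labels ω.1)
          + riskConst C B M * (Real.sqrt (T / (n * (1 - α) ^ 2))
            + Real.sqrt (lam / (n * (1 - α))))}) ?_ ?_
  · refine key.trans ((add_le_add_left (measure_not_typicalLabels_le (hμ none) hn hu) _).trans ?_)
    rw [hexpu, ← ENNReal.ofReal_add (by positivity) (by positivity), add_halves]
  · -- the deviation is small, given typical labels and a mask
    intro y hy s hs h0
    have hyt : TypicalLabels D u y := not_not.1 hy
    obtain ⟨hsc, hsα⟩ := hsel y s hs
    have hDy : ∀ i, D (classSet X (y i)) ≠ 0 := fun i => by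
      rw [← measure_blockClass (hμ none)]; exact h0 i
    have hv := weight_nonneg c y s
    have hvW₀ : ∀ it, weight c y s it ≤ W₀ := fun it => by
      refine (weight_le hα₀ hα₁ hsc hsα it).trans ?_
      split_ifs
      exacts [hW₀0, le_rfl]
    have hvW : ∀ i, ∑ o, weight c y s (i, o) ≤ W := fun i => by
      calc ∑ o, weight c y s (i, o) ≤ ∑ _o : Option (Fin m), W₀ :=
            Finset.sum_le_sum fun o _ => hvW₀ _
        _ = W := by rw [← hWW]; simp
    have hmean : ∫ w, deviation D ℓ (weight c y s) y w
        ∂Measure.pi (fun i => μ[|blockClass X m (y i)]) ≤ E := by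
      refine (integral_deviation_le hcls hB.le (by positivity) hW₀0 hv hvW₀ hDy hμ).trans ?_
      have hφ' : ∀ (t : S) j, Measurable fun z : X × Fin C => φ t z.1 j := fun t j =>
        (hcls.measurable_model t j).comp measurable_fst
      have hM' : ∀ (t : S) (z : X × Fin C) j, |φ t z.1 j| ≤ M := fun t z j => hfM t z.1 j
      have hR : partRad (fun (t : S) (z : X × Fin C) => φ t z.1) D
          (Finset.univ : Finset (Fin n)) ≤ n * Real.sqrt (T / n) := by
        rw [← mul_rademacher_eq hfc hSd hn D]
        gcongr
      have hparts : ∀ c', partRad (fun (t : S) (z : X × Fin C) => φ t z.1) (D[|classSet X c'])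
          (Finset.univ.filter fun i => y i = c')
          ≤ 10 * (n * Real.sqrt (T / n)) + (3 * u + 2) * (C * M) := by
        intro c'
        rcases eq_or_ne (D (classSet X c')) 0 with h2 | h2
        · have he : (Finset.univ.filter fun i => y i = c') = ∅ :=
            Finset.filter_eq_empty_iff.2 fun i _ hi => hDy i (by rw [hi]; exact h2)
          have : partRad (fun (t : S) (z : X × Fin C) => φ t z.1) (D[|classSet X c'])
              (∅ : Finset (Fin n)) = 0 := by
            simp [partRad, rad, signSum, restrictTo]
          rw [he, this]
          positivity
        · have h3 := partRad_cond_le hφ' hM' hM D (measurableSet_classSet c') h2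
            (Finset.univ.filter fun i => y i = c') hu (hyt c').1
          rw [Fintype.card_fin] at h3
          linarith
      have e : (m + 1) * (2 * (2 * C * W₀) * ∑ c', partRad (fun (t : S) (z : X × Fin C) => φ t z.1)
          (D[|classSet X c']) (Finset.univ.filter fun i => y i = c'))
          = 4 * C / (n * (1 - α)) * ∑ c', partRad (fun (t : S) (z : X × Fin C) => φ t z.1)
          (D[|classSet X c']) (Finset.univ.filter fun i => y i = c') := by
        have : 4 * C / (n * (1 - α)) = 4 * C * W := by rw [hW]; ring
        rw [this, ← hWW]; ring
      rw [e, hEdef, deviationBound]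
      refine mul_le_mul_of_nonneg_left ?_ (by positivity)
      refine (Finset.sum_le_sum fun c' _ => hparts c').trans (le_of_eq ?_)
      rw [Finset.sum_const, Finset.card_univ, Fintype.card_fin, nsmul_eq_mul]
    have htail := measureReal_deviation_ge_le hcls hB hv (sum_weight hn hα₁ hsc hsα).le hW0 hvW h0
      hmean hlam0
    have hpr : ∀ i, IsProbabilityMeasure (μ[|blockClass X m (y i)]) :=
      fun i => cond_isProbabilityMeasure (h0 i)
    rw [hexp] at htail
    rw [← ofReal_measureReal]
    exact ENNReal.ofReal_le_ofReal htail
  · -- outside the two exceptional events the bound holds on the dense set, hence everywhere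
    rintro ⟨w, s⟩ hω hy hs
    have hyt : TypicalLabels D u (labels w) := not_not.1 hy
    obtain ⟨hsc, hsα⟩ := hsel _ s hs
    by_contra hdev
    have hdev' : deviation D ℓ (weight c (labels w) s) (labels w) w
        < E + Real.sqrt (B ^ 2 * W * lam / 2) := not_le.1 hdev
    refine hω fun x' θ => ?_
    have hnum := complexity_terms_le hC hn (T := T) hα₀ hα₁ hB.le hM hδ hδ1 hr
    have hcE : Continuous fun θ => cleanError loss D (f θ) := by
      refine continuous_of_dominated (bound := fun _ => B) (fun θ => ?_) (fun θ => ?_)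
        (integrable_const _) ?_
      · exact (measurable_from_prod_countable_left fun y => hlossm θ y).aestronglyMeasurable
      · exact Filter.Eventually.of_forall fun z => by
          rw [Real.norm_of_nonneg (hloss₀ _ _ _)]; exact hlossB _ _ _
      · exact Filter.Eventually.of_forall fun z => hcont z.1 z.2
    have hcR : Continuous fun θ => empRisk loss (f θ) (poisonedImages w s x') (labels w) :=
      (continuous_finsetSum _ fun it _ => hcont _ _).div_const _
    have hcl : IsClosed {θ | cleanError loss D (f θ) ≤ 1 / (1 - α)
            * empRisk loss (f θ) (poisonedImages w s x') (labels w)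
          + riskConst C B M * (Real.sqrt (T / (n * (1 - α) ^ 2))
            + Real.sqrt (lam / (n * (1 - α))))} :=
      isClosed_le hcE ((hcR.const_mul _).add_const _)
    refine hcl.closure_subset_iff.2 (fun t ht => ?_) (hSd θ)
    have h2 := risk_le_of_typicalLabels hcls hB.le hn hyt hα₁ hsc hsα ⟨t, ht⟩
    have h3 := sum_weight_mul_loss_le hα₀ hα₁ hsc hsα (hloss₀ t) w x'
    change cleanError loss D (f t) ≤ _
    change cleanError loss D (f t) ≤ _ at h2
    change _ ≤ 1 / (1 - α) * empRisk loss (f t) (poisonedImages w s x') (labels w) at h3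
    linarith

end Risk

end CleanLabel

end

theorem theorem5p1 (C : ℕ) (𝒪 : Set (CleanLabel.Output C)) (h𝒪 : Bornology.IsBounded 𝒪)
    (loss : CleanLabel.Output C → Fin C → ℝ) (hloss : ∀ p ∈ 𝒪, ∀ y, 0 ≤ loss p y)
    (L : ℝ≥0) (hL : L ≤ 2) (hlip : ∀ y, LipschitzOnWith L (fun p => loss p y) 𝒪) :
    ∃ K : ℝ, 0 ≤ K ∧
      ∀ (X : Type*) [MeasurableSpace X] (D : Measure (X × Fin C)) [IsProbabilityMeasure D]
        (m : ℕ) (G : Kernel (X × Fin C) (Fin m → X)) [IsMarkovKernel G]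
        (_hG : ∀ k : Fin m, (D.compProd G).map (fun b => (b.2 k, b.1.2)) = D)
        (Θ : Type*) [TopologicalSpace Θ] [SecondCountableTopology Θ]
        (f : Θ → X → CleanLabel.Output C)
        (_hf : ∀ θ, Measurable (f θ)) (_hfc : ∀ x, Continuous fun θ => f θ x)
        (_hf𝒪 : ∀ θ x, f θ x ∈ 𝒪)
        (n : ℕ) (_hn : 0 < n) (c : Fin C) (α : ℝ) (_hα₀ : 0 ≤ α) (_hα₁ : α < 1)
        (sel : (Fin n → Fin C) → PMF (CleanLabel.Mask n m))
        (_hsel : CleanLabel.IsSelection c α sel)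
        (T : ℝ) (_hT₀ : 0 ≤ T) (_hT : CleanLabel.rademacher n D f ≤ Real.sqrt (T / n))
        (δ : ℝ) (_hδ : 0 < δ),
        -- the (outer) probability that the bound fails is at most `δ + K / n`
        CleanLabel.attackLaw D G sel
          {ω | ¬ ∀ (x' : CleanLabel.Item n m → X) (h : X → CleanLabel.Output C) (η ξ : ℝ)
              (θstar θ : Θ),
            (∀ x, h x ∈ 𝒪) →
            (∀ x, ‖f θstar x - h x‖ ≤ η) →
            CleanLabel.empRisk loss h (CleanLabel.poisonedImages ω.1 ω.2 x')
              (CleanLabel.labels ω.1) = ξ →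
            (CleanLabel.IsERM loss f (CleanLabel.poisonedImages ω.1 ω.2 x')
              (CleanLabel.labels ω.1) θ ∨ θ = θstar) →
            CleanLabel.cleanError loss D (f θ) ≤
              (4 - 2 * α) / (1 - α) * (ξ + 2 * η) +
                K * (Real.sqrt (T / (n * (1 - α) ^ 2)) +
                  Real.sqrt (Real.log (2 / δ) / (n * (1 - α))))}
          ≤ ENNReal.ofReal (δ + K / n) := by
  classical
  open CleanLabel in
  -- the loss, extended from `𝒪` to a Lipschitz function
  choose loss' hlip' heq using fun y => (hlip y).extend_real
  have hlip2 : ∀ y, LipschitzWith 2 (loss' y) := fun y => (hlip' y).weaken hL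
  obtain ⟨M, hM⟩ := h𝒪.exists_norm_le
  have hbdd : ∀ p ∈ 𝒪, ∀ y, loss p y ≤ (∑ y, |loss' y 0|) + 2 * |M| + 1 := by
    intro p hp y
    have h1 := (hlip2 y).dist_le_mul p 0
    rw [Real.dist_eq, dist_zero_right] at h1
    have h2 : loss p y = loss' y p := heq y hp
    have h3 : |loss' y 0| ≤ ∑ y, |loss' y 0| :=
      Finset.single_le_sum (f := fun y => |loss' y 0|) (fun _ _ => abs_nonneg _)
        (Finset.mem_univ y)
    have h4 : loss' y p - loss' y 0 ≤ 2 * |M| := by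
      refine (le_abs_self _).trans (h1.trans ?_)
      push_cast
      gcongr
      exact (hM p hp).trans (le_abs_self _)
    linarith [le_abs_self (loss' y 0)]
  set B := (∑ y, |loss' y 0|) + 2 * |M| + 1 with hBdef
  have hB : 0 < B := by positivity
  refine ⟨max 0 (riskConst C B |M|), le_max_left _ _, ?_⟩
  intro X _ D _ m G _ hG Θ _ _ f hf hfc hf𝒪 n hn c α hα₀ hα₁ sel hsel T hT₀ hT δ hδ
  have hC : 0 < C := c.pos
  have h1 : 0 < 1 - α := by linarith
  have hK : max 0 (riskConst C B |M|) = riskConst C B |M| :=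
    max_eq_right (hB.le.trans (le_riskConst hC hB.le (abs_nonneg M)))
  have hK0 : 0 ≤ riskConst C B |M| := hK ▸ le_max_left _ _
  rw [hK]
  obtain ⟨x₀⟩ : Nonempty X := by
    by_contra hX
    rw [not_nonempty_iff] at hX
    exact IsProbabilityMeasure.ne_zero D (Measure.eq_zero_of_isEmpty D)
  have hl : ∀ p ∈ 𝒪, ∀ y, loss' y p = loss p y := fun p hp y => (heq y hp).symm
  have key := attackLaw_risk_le (loss := fun p y => loss' y p) hB (abs_nonneg M) hlip2 D G hG hf hfc
    (fun θ x y => by rw [hl _ (hf𝒪 θ x)]; exact hloss _ (hf𝒪 θ x) y)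
    (fun θ x y => by rw [hl _ (hf𝒪 θ x)]; exact hbdd _ (hf𝒪 θ x) y)
    (fun θ x j => (PiLp.norm_apply_le (f θ x) j).trans ((hM _ (hf𝒪 θ x)).trans (le_abs_self M)))
    hn hα₀ hα₁ hsel hT hδ
  refine (measure_mono fun ω hω => ?_).trans (key.trans (ENNReal.ofReal_le_ofReal ?_))
  swap
  · have : 0 ≤ riskConst C B |M| / n := by positivity
    linarith
  intro hgood
  refine hω fun x' h η ξ θstar θ hh hη hξ hθ => ?_
  have hbound := hgood x' θ
  have hce : cleanError (fun p y => loss' y p) D (f θ) = cleanError loss D (f θ) := by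
    simp only [cleanError, hl _ (hf𝒪 θ _)]
  have hem : empRisk (fun p y => loss' y p) (f θ) (poisonedImages ω.1 ω.2 x') (labels ω.1)
      = empRisk loss (f θ) (poisonedImages ω.1 ω.2 x') (labels ω.1) := by
    simp only [empRisk, hl _ (hf𝒪 θ _)]
  rw [hce, hem] at hbound
  have hη0 : 0 ≤ η := (norm_nonneg _).trans (hη x₀)
  have hξ0 : 0 ≤ ξ := by
    rw [← hξ]
    exact div_nonneg (Finset.sum_nonneg fun it _ => hloss _ (hh _) _) (Nat.cast_nonneg _)
  have hcard : (0 : ℝ) < Fintype.card (Item n m) := by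
    rw [card_item]; positivity
  have hstar : empRisk loss (f θstar) (poisonedImages ω.1 ω.2 x') (labels ω.1) ≤ ξ + 2 * η := by
    rw [← hξ, empRisk, empRisk, ← sub_le_iff_le_add', ← sub_div, ← Finset.sum_sub_distrib,
      div_le_iff₀ hcard]
    calc _ ≤ ∑ _it : Item n m, 2 * η := by
          refine Finset.sum_le_sum fun it _ => ?_
          have h2 := (hlip2 (labels ω.1 it.1)).dist_le_mul
            (f θstar (poisonedImages ω.1 ω.2 x' it)) (h (poisonedImages ω.1 ω.2 x' it))
          rw [Real.dist_eq, dist_eq_norm, hl _ (hf𝒪 _ _), hl _ (hh _)] at h2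
          refine (le_abs_self _).trans (h2.trans ?_)
          push_cast
          gcongr
          exact hη _
      _ = _ := by simp; ring
  have hθR : empRisk loss (f θ) (poisonedImages ω.1 ω.2 x') (labels ω.1) ≤ ξ + 2 * η := by
    rcases hθ with hθ | rfl
    · exact (hθ θstar).trans hstar
    · exact hstar
  have hfac : 1 / (1 - α) * empRisk loss (f θ) (poisonedImages ω.1 ω.2 x') (labels ω.1)
      ≤ (4 - 2 * α) / (1 - α) * (ξ + 2 * η) := by
    refine mul_le_mul ?_ hθR ?_ (by apply div_nonneg <;> linarith)
    · gcongr; linarith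
    · exact div_nonneg (Finset.sum_nonneg fun it _ => hloss _ (hf𝒪 _ _) _) (Nat.cast_nonneg _)
  linarith
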